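/- Let $G$ be a finite connected multigraph (multiple edges and self-loops are allowed) with edge set $\mathcal E$, at least three edges and at least four vertices (the latter is automatic for at least five edges), and with $2h_1(G)\le|\mathcal E|$, where $h_1(G)$ is the number of independent cycles. Let $q=p^k$ be a power of an odd prime $p$. The graph polynomial of $G$ is $\Psi_G=\sum_{T}\prod_{e\notin T}\alpha_e\in\mathbb Z[\alpha_e:e\in\mathcal E]$, the sum being over all spanning trees $T$ of $G$. Let $[\Psi_G]_q$ be the number of zeros of $\Psi_G$ in $\mathbb F_q^{\mathcal E}$. For $F\in\mathbb Z[\alpha_1,\dots,\alpha_N]$ put $(F)_q=\sum_{\alpha\in\mathbb F_q^N}\left(\frac{F(\alpha)}{q}\right)\in\mathbb Z$, where $\left(\frac{a}{q}\right)=|\{x\in\mathbb F_q:x^2=a\}|-1$ for $a\in\mathbb F_q$. Orient the edges of $G$ arbitrarily and let $L_K$ be the symmetric matrix, with rows and columns labelled by the edges and vertices of $G$, $L_K=\begin{pmatrix}A_K&M^T\\M&0\end{pmatrix}$, where $A_K$ is the diagonal matrix of the $\alpha_e$ with $\alpha_k$ set to $0$ for $k\in K$, and $M$ is the signed incidence matrix.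 For words $I,J$ of equal length in distinct edges and $K\subseteq\mathcal E$ let the Dodgson polynomial $\Psi^{I,J}_K$ be $\pm$ the determinant of $L_K$ with the rows $I,v$ and the columns $J,v$ removed, where $v$ is any vertex (up to sign it does not depend on the choices, and the sign is irrelevant below). For distinct edges $1,2,3$ put ${}^3\Psi^2_G(1,2,3)=\bigl[\Psi^{13,23}_{\emptyset}\,\Psi^{1,2}_{3}\bigr]^2$. Suppose that ${}^n\Psi^2_G={}^n\Psi^2_G(1,\dots,n)$ is defined for distinct edges $1,\dots,n$, $n\ge3$, let $n+1$ be a further edge, and write $\alpha=\alpha_{n+1}$. If ${}^n\Psi^2_G=(A\alpha^2+B\alpha+C)^2$, put ${}^{n+1}\Psi^2_G=B^2-4AC$; if ${}^n\Psi^2_G=(A\alpha^2+B\alpha+C)(D\alpha+E)^2$, put ${}^{n+1}\Psi^2_G=AE^2-BDE+CD^2$. Here $A,B,C,D,E$ are integer polynomials in the variables of the edges other than $1,\dots,n+1$. If neither form is possible, the reduction terminates. If it exists, ${}^n\Psi^2_G$ is called a quadratic $n$-invariant of $G$; it is a polynomial in the $|\mathcal E|-n$ variables of the remaining edges. Then $[\Psi_G]_q$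 is divisible by $q^2$, and with $c_2^{(q)}(G)\equiv[\Psi_G]_q/q^2\bmod q$ we have, whenever a quadratic $n$-invariant ${}^n\Psi^2_G$ exists (for any sequence of $n\ge 3$ distinct edges), $$c_2^{(q)}(G)\equiv(-1)^{n-1}\,({}^n\Psi^2_G)_q\mod p .$$ -/

import Mathlib

open MvPolynomial

/-- A multigraph with vertex set `V` and edge set `E`: every edge begins in `src e` and ends in
`tgt e`. Multiple edges and self-loops are allowed, and the orientation is arbitrary. -/
structure Multigraph (V E : Type*) where
  src : E → V
  tgt : E → V

namespace Multigraph

/-- The spanning subgraph with all vertices and the edges in `T` is connected (in particular there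
is at least one vertex). -/
def ConnectedBy {V E : Type*} (G : Multigraph V E) (T : Finset E) : Prop :=
  (SimpleGraph.fromRel fun u v : V => ∃ e ∈ T, G.src e = u ∧ G.tgt e = v).Connected

/-- The graph is connected. -/
def IsConnected {V E : Type*} [Fintype E] (G : Multigraph V E) : Prop :=
  G.ConnectedBy Finset.univ

/-- `T` is the edge set of a spanning tree: the spanning subgraph given by `T` is connected and
has `|V| - 1` edges. -/
def IsSpanningTree {V E : Type*} [Fintype V] (G : Multigraph V E) (T : Finset E) : Prop :=
  G.ConnectedBy T ∧ T.card + 1 = Fintype.card V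

/-- The signed incidence matrix: `1` if `e` begins in `v`, `-1` if `e` ends in `v`, and `0` if
`e` is not incident to `v` or is a self-loop. -/
def incidence {V E : Type*} [DecidableEq V] (G : Multigraph V E) (R : Type*) [CommRing R] :
    Matrix V E R :=
  Matrix.of fun v e => (if G.src e = v then 1 else 0) - (if G.tgt e = v then 1 else 0)

/-- The number `h₁` of independent cycles (first Betti number): the dimension of the cycle space,
i.e. of the kernel of the boundary map `ℚ^E → ℚ^V`. -/
noncomputable def h1 {V E : Type*} [DecidableEq V] [Fintype E] (G : Multigraph V E) : ℕ :=
  Module.finrank ℚ (LinearMap.ker (G.incidence ℚ).mulVecLin)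

open Classical in
/-- The graph polynomial: the sum over all spanning trees `T` of `∏_{e ∉ T} α_e`. -/
noncomputable def graphPolynomial {V E : Type*} [Fintype V] [Fintype E] (G : Multigraph V E) :
    MvPolynomial E ℤ :=
  ∑ T : Finset E with G.IsSpanningTree T, ∏ e ∈ Tᶜ, X e

/-- The number of zeros of the graph polynomial in `F^E`. -/
noncomputable def pointCount {V E : Type*} [Fintype V] [Fintype E] (G : Multigraph V E)
    (F : Type*) [Field F] : ℕ :=
  Nat.card {x : E → F // aeval x G.graphPolynomial = 0}

/-- The `c₂`-invariant at `q = |F|`, as an integer representing the class of the point count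
divided by `q²`. (It is only meaningful when `q²` divides the point count.) -/
noncomputable def c2 {V E : Type*} [Fintype V] [Fintype E] (G : Multigraph V E)
    (F : Type*) [Field F] : ℕ :=
  G.pointCount F / Nat.card F ^ 2

/-- The expanded Laplacian with `α_k` set to zero for `k ∈ K`: the diagonal matrix of the edge
variables, bordered by the signed incidence matrix and its transpose. -/
noncomputable def laplacian {V E : Type*} [DecidableEq V] [DecidableEq E] (G : Multigraph V E)
    (K : Finset E) : Matrix (E ⊕ V) (E ⊕ V) (MvPolynomial E ℤ) :=
  Matrix.fromBlocks (Matrix.diagonal fun e => if e ∈ K then 0 else X e)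
    (G.incidence (MvPolynomial E ℤ)).transpose
    (G.incidence (MvPolynomial E ℤ)) 0

/-- The signed minor of `M` obtained by removing the rows `A = a₁ ⋯ a_k` and the columns
`B = b₁ ⋯ b_k` (words of equal length without repeated letters, zero otherwise), with the sign
`(-1)^{∑ ι(a_i) + ∑ ι(b_j)} sgn(A) sgn(B)` for any ordering `ι` of the index set.
It is written, as the cofactors in the definition of the adjugate, as the determinant of
the matrix whose rows `a_i` are replaced by the unit vectors with a `1` in column `b_i`;
expanding along these rows leaves the minor with exactly this sign. -/
def signedMinor {n R : Type*} [Fintype n] [DecidableEq n] [CommRing R] (M : Matrix n n R)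
    (A B : List n) : R :=
  if A.Nodup ∧ B.Nodup ∧ A.length = B.length then
    ((A.zip B).foldl (fun N ab => N.updateRow ab.1 (Pi.single ab.2 1)) M).det
  else 0

/-- The Dodgson polynomial `Ψ^{I,J}_K`: the signed minor of the expanded Laplacian with rows
`I v` and columns `J v` removed, times `(-1)^{|V| - 1}`. (It does not depend on `v`.) -/
noncomputable def dodgson {V E : Type*} [Fintype V] [Fintype E] [DecidableEq V] [DecidableEq E]
    (G : Multigraph V E) (v : V) (I J : List E) (K : Finset E) : MvPolynomial E ℤ :=
  (-1) ^ (Fintype.card V - 1) *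
    signedMinor (G.laplacian K) (I.map Sum.inl ++ [Sum.inr v]) (J.map Sum.inl ++ [Sum.inr v])

/-- The integer polynomials in the variables `α_e` with `e` not in the list `l`. -/
noncomputable def remaining {E : Type*} (l : List E) : Subalgebra ℤ (MvPolynomial E ℤ) :=
  supported ℤ {e | e ∉ l}

/-- `G.IsQuadraticInvariant l P`: quadratic denominator reduction along the sequence `l` of
`n = l.length ≥ 3` distinct edges is possible and yields the quadratic `n`-invariant `P`. -/
inductive IsQuadraticInvariant {V E : Type*} [Fintype V] [Fintype E] [DecidableEq V]
    [DecidableEq E] (G : Multigraph V E) : List E → MvPolynomial E ℤ → Prop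
  /-- `³Ψ²(1,2,3) = (Ψ^{13,23} Ψ^{1,2}_3)²`. -/
  | initial (v : V) (e₁ e₂ e₃ : E) (hd : [e₁, e₂, e₃].Nodup) :
      IsQuadraticInvariant G [e₁, e₂, e₃]
        ((G.dodgson v [e₁, e₃] [e₂, e₃] ∅ * G.dodgson v [e₁] [e₂] {e₃}) ^ 2)
  /-- From `(A α² + B α + C)²` to `B² - 4 A C`. -/
  | square {l : List E} {P : MvPolynomial E ℤ} (h : IsQuadraticInvariant G l P)
      (e : E) (he : e ∉ l) (A B C : MvPolynomial E ℤ)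
      (hA : A ∈ remaining (l ++ [e])) (hB : B ∈ remaining (l ++ [e]))
      (hC : C ∈ remaining (l ++ [e]))
      (hP : P = (A * X e ^ 2 + B * X e + C) ^ 2) :
      IsQuadraticInvariant G (l ++ [e]) (B ^ 2 - 4 * A * C)
  /-- From `(A α² + B α + C) (D α + E)²` to `A E² - B D E + C D²`
  (the coefficient `E` is called `E₀` here). -/
  | squareFactor {l : List E} {P : MvPolynomial E ℤ} (h : IsQuadraticInvariant G l P)
      (e : E) (he : e ∉ l) (A B C D E₀ : MvPolynomial E ℤ)
      (hA : A ∈ remaining (l ++ [e])) (hB : B ∈ remaining (l ++ [e]))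
      (hC : C ∈ remaining (l ++ [e])) (hD : D ∈ remaining (l ++ [e]))
      (hE : E₀ ∈ remaining (l ++ [e]))
      (hP : P = (A * X e ^ 2 + B * X e + C) * (D * X e + E₀) ^ 2) :
      IsQuadraticInvariant G (l ++ [e]) (A * E₀ ^ 2 - B * D * E₀ + C * D ^ 2)

end Multigraph

/-- The Legendre sum `(P)_q`, `q = |F|`, of a polynomial in the variables `α_e`, `e ∉ l`: the sum
of the Legendre symbols (quadratic characters) of the values of `P` at all points of `F^{e ∉ l}`.
For `e ∈ l`, where `P` does not depend on `α_e`, zero is inserted. -/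
noncomputable def legendreSum {E : Type*} [Fintype E] [DecidableEq E] (F : Type*) [Field F] [Fintype F]
    [DecidableEq F] (l : List E) (P : MvPolynomial E ℤ) : ℤ :=
  ∑ x : {e // e ∉ l} → F,
    quadraticChar F (aeval (fun e => if h : e ∉ l then x ⟨e, h⟩ else 0) P)

/-!
Fix a vertex `v`, let `W` be the set of the other vertices and `r = |V| - 1`, and let `M` be the
incidence matrix without the row of `v`. By the matrix-tree theorem (`graphPolynomial_eq`) `Ψ_G` is,
up to sign, the determinant of the bordered matrix `(diag α, Mᵀ; M, 0)`, and the Dodgson polynomials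
are its minors. So the count takes place for an arbitrary matrix `M` with `N` columns and `r ≥ 3`
rows over `𝔽_q`, with `N ≤ 2 r`, which follows from `2 h₁ ≤ N`. Deleting edges `Δ` gives
determinants `D_Δ` and minors `C_Δ^{i,j}` (`borderedDet`, `borderedMinor`). They are affine in every
variable, of degree at most `N - |Δ| - r` and `N - |Δ| - r - 1`.

*From the point count to the three-edge invariant.* For two edges `i`, `j` Jacobi's identity
`D_i D_j - (C^{i,j})² = D D_{ij}` (`adjugate_minor`) makes the number of zeros `(α_i, α_j)` of `D`
explicit (`sum_sum_biaffine_eq_zero`):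
`[D] = q² [D, D_i, D_j, D_{ij}] + q [C^{i,j}] + (q + 1) q^{N-2} - [D_i] - [D_j] - [D_{ij}]`.
The first count is divisible by `p`: the four polynomials vanish together iff the bordered matrix
has a nonzero kernel vector whose coordinates at `i` and `j` vanish
(`borderedDet_four_eq_zero_iff`), and counting pairs of a point and such a vector leaves, modulo
`p`, the size of a vector space of dimension at least `r - 2 > 0` (`dvd_sum_zeroOn_four`). If
`N < 2 r`, then induction on the number of edges and the Chevalley–Warning theorem give
`p q ∣ [C^{i,j}]` and `p q² ∣ [D]`. For `N ≤ 2 r` this applies to all terms with a deleted edge,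
so that `[D] ≡ q [C^{i,j}]` modulo `p q²`. Finally `C^{i,j} = f α_e + g` for a third edge `e`, with
`f = Ψ^{ie,je}` and `g = Ψ^{i,j}_e`, and again by Chevalley–Warning
`[C^{i,j}] ≡ q [f, g] ≡ -q [f g]` modulo `p q`. As `-[f g]` is congruent to the Legendre sum of
`(f g)²`, this is the case of three edges (`dvd_numZeros_borderedDet_sub`). It needs no assumption
on the rank of `M`, and so none on the connectedness of the graph.

*From `n` to `n + 1` edges.* For fixed coefficients the Legendre sum over `α` of `(Aα² + Bα + C)²`
is `-χ(B² - 4AC) - χ(A²)` modulo `p`, and that of `(Aα² + Bα + C)(Dα + E)²` is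
`-χ(AE² - BDE + CD²) - χ(AD²)`. An `n`-invariant has degree at most `2 (N - n)`, so the leading
coefficients `A²` and `AD²` have degree less than twice the number of remaining variables, and their
Legendre sums vanish modulo `p`. Hence each reduction changes the sign of the Legendre sum.
-/

open Matrix

/-! ### Determinants, minors and kernels -/

namespace Matrix

variable {ι R : Type*} [Fintype ι] [DecidableEq ι] [CommRing R]

/-- Once a row is the unit vector at its diagonal place, the rest of the column is irrelevant. -/
theorem det_updateCol_single_one_of_row_eq (A : Matrix ι ι R) (i : ι)
    (h : A i = Pi.single i 1) : (A.updateCol i (Pi.single i 1)).det = A.det := by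
  have h1 : A.adjugate i i = (A.updateRow i (Pi.single i 1)).det := adjugate_apply A i i
  have h2 : Aᵀ.adjugate i i = (Aᵀ.updateRow i (Pi.single i 1)).det := adjugate_apply Aᵀ i i
  rw [← adjugate_transpose, transpose_apply, h1, updateRow_transpose, det_transpose] at h2
  rw [← h2, ← h, updateRow_eq_self]

theorem det_updateRow_add_smul (A : Matrix ι ι R) (i : ι) (a : R) (u : ι → R) :
    (A.updateRow i (A i + a • u)).det = A.det + a * (A.updateRow i u).det := by
  rw [det_updateRow_add, det_updateRow_smul, updateRow_eq_self]

/-- Jacobi's identity for complementary `2 × 2` minors, multiplied by `det A`: compare determinants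
in `A * T`, where `T` is the identity matrix with the columns `i` and `j` of `adjugate A`. -/
theorem det_mul_adjugate_minor (A : Matrix ι ι R) {i j : ι} (hij : i ≠ j) :
    A.det * (A.adjugate i i * A.adjugate j j - A.adjugate i j * A.adjugate j i) =
      A.det * (A.det * ((A.updateCol i (Pi.single i 1)).updateCol j (Pi.single j 1)).det) := by
  set c : ι → R := A.adjugate.col i with hc
  set d : ι → R := A.adjugate.col j with hd
  set T : Matrix ι ι R := ((1 : Matrix ι ι R).updateCol i c).updateCol j d with hT
  have hTdet : T.det = A.adjugate i i * A.adjugate j j - A.adjugate i j * A.adjugate j i := by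
    have hT1 : T = 1 + (of fun a (k : Fin 2) => ![c a - (1 : Matrix ι ι R) a i,
        d a - (1 : Matrix ι ι R) a j] k) * (of fun (k : Fin 2) b =>
          ![(1 : Matrix ι ι R) i b, (1 : Matrix ι ι R) j b] k) := by
      ext a b
      rw [add_apply, mul_apply, Fin.sum_univ_two]
      by_cases hb : b = j
      · subst hb
        simp [hT, hij]
      · by_cases hb' : b = i
        · subst hb'
          simp [hT, hij, hij.symm]
        · simp [hT, hb, hb', one_apply_ne (Ne.symm hb), one_apply_ne (Ne.symm hb')]
    rw [hT1, det_one_add_mul_comm, det_fin_two]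
    simp only [add_apply, mul_apply, of_apply, Fin.isValue, Matrix.cons_val_zero,
      Matrix.cons_val_one, one_apply, ite_mul, one_mul, zero_mul, Finset.sum_ite_eq,
      Finset.mem_univ, if_true, hij, hij.symm, if_false, hc, hd, col_apply]
    simp
  have hAT : A * T = (A.updateCol i (A.det • Pi.single i 1)).updateCol j
      (A.det • Pi.single j 1) := by
    have key : ∀ k, A *ᵥ A.adjugate.col k = A.det • Pi.single k 1 := by
      intro k
      ext a
      have := congrFun (congrFun (mul_adjugate A) a) k
      rw [mul_apply] at this
      simpa [mulVec, dotProduct, Pi.single_apply, one_apply] using this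
    rw [hT, mul_updateCol, mul_updateCol, Matrix.mul_one, hc, hd, key, key]
  rw [← hTdet, ← det_mul, hAT, det_updateCol_smul, updateCol_comm _ hij, det_updateCol_smul,
    updateCol_comm _ hij.symm]

/-- **Jacobi's identity** for complementary `2 × 2` minors (Dodgson condensation). The factor `det A`
in `det_mul_adjugate_minor` is cancelled for the generic matrix `A + X`. -/
theorem adjugate_minor (A : Matrix ι ι R) {i j : ι} (hij : i ≠ j) :
    A.adjugate i i * A.adjugate j j - A.adjugate i j * A.adjugate j i =
      A.det * ((A.updateRow i (Pi.single i 1)).updateRow j (Pi.single j 1)).det := by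
  let B : Matrix ι ι (Polynomial R) := Aᵀ.map Polynomial.C + (Polynomial.X : Polynomial R) • 1
  let f : Polynomial R →+* R := Polynomial.evalRingHom 0
  have hB : f.mapMatrix B = Aᵀ := by
    ext a b
    simp [B, f]
  have hreg : IsLeftRegular B.det := by
    apply IsRegular.left
    refine Polynomial.Monic.isRegular ?_
    simp only [B, Polynomial.Monic.def, ← Polynomial.leadingCoeff_det_X_one_add_C Aᵀ, add_comm]
  have h := congrArg f (hreg (det_mul_adjugate_minor B hij))
  have hadj : ∀ a b, f (B.adjugate a b) = A.adjugate b a := by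
    intro a b
    have h1 := congrFun (congrFun (f.map_adjugate B) a) b
    rw [hB, ← adjugate_transpose] at h1
    exact h1
  have hdet : f B.det = A.det := by
    rw [f.map_det, hB, det_transpose]
  have hsingle : ∀ k : ι, (fun a => f ((Pi.single k 1 : ι → Polynomial R) a)) = Pi.single k 1 := by
    intro k
    ext a
    by_cases ha : a = k
    · subst ha; simp
    · simp [ha]
  rw [map_mul, map_sub, map_mul, map_mul, hadj, hadj, hadj, hadj, hdet, f.map_det,
    RingHom.mapMatrix_apply, map_updateCol, map_updateCol, ← RingHom.mapMatrix_apply, hB] at h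
  rw [mul_comm (A.adjugate i j), h, updateCol_transpose, updateCol_transpose, det_transpose]
  simp only [Function.comp_def, hsingle]

/-- If every nonzero entry `(a, b)` has degree at most `u a + v b`, then every nonzero
term of the Leibniz formula has degree at most `∑ u + ∑ v`. -/
theorem totalDegree_det_le {σ : Type*} (A : Matrix ι ι (MvPolynomial σ R)) (u v : ι → ℤ)
    (h : ∀ a b, A a b ≠ 0 → ((A a b).totalDegree : ℤ) ≤ u a + v b) (h0 : A.det ≠ 0) :
    (A.det.totalDegree : ℤ) ≤ ∑ a, u a + ∑ a, v a := by
  have key : ∀ s : Equiv.Perm ι, ∏ i, A (s i) i ≠ 0 →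
      ((∏ i, A (s i) i).totalDegree : ℤ) ≤ ∑ a, u a + ∑ a, v a := by
    intro s hs
    calc ((∏ i, A (s i) i).totalDegree : ℤ) ≤ ∑ i, ((A (s i) i).totalDegree : ℤ) := by
          exact_mod_cast totalDegree_finsetProd _ _
      _ ≤ ∑ i, (u (s i) + v i) := by
          refine Finset.sum_le_sum fun i _ => h _ _ fun h0 => hs ?_
          exact Finset.prod_eq_zero (Finset.mem_univ i) h0
      _ = _ := by rw [Finset.sum_add_distrib, Equiv.sum_comp s u]
  have hnn : 0 ≤ ∑ a, u a + ∑ a, v a := by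
    by_contra hneg
    apply h0
    rw [det_apply]
    refine Finset.sum_eq_zero fun s _ => ?_
    by_cases hs : ∏ i, A (s i) i = 0
    · rw [hs, smul_zero]
    · have := key s hs
      omega
  have : A.det.totalDegree ≤ (∑ a, u a + ∑ a, v a).toNat := by
    rw [det_apply]
    refine totalDegree_finsetSum_le fun s _ => ?_
    refine (totalDegree_smul_le _ _).trans ?_
    by_cases hs : ∏ i, A (s i) i = 0
    · simp [hs]
    · have := key s hs
      omega
  omega

/-- Pairing `A w = -w i • e_i` with a kernel vector `v` of the symmetric matrix `A` gives
`w i * v i = 0`. -/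
theorem mulVec_eq_zero_of_add_single {K : Type*} [Field K] {A : Matrix ι ι K} (hA : A.IsSymm)
    {i : ι} {v w : ι → K} (hv : A *ᵥ v = 0) (hvi : v i ≠ 0) (hw : (A + single i i 1) *ᵥ w = 0) :
    A *ᵥ w = 0 ∧ w i = 0 := by
  have e1 : A *ᵥ w = - w i • Pi.single i 1 := by
    rw [add_mulVec, single_mulVec, add_eq_zero_iff_eq_neg] at hw
    rw [hw, neg_smul, one_mul]
    ext a
    by_cases ha : a = i
    · subst ha; simp
    · simp [ha]
  have e2 : v ⬝ᵥ (A *ᵥ w) = 0 := by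
    rw [dotProduct_mulVec, ← mulVec_transpose, hA.eq, hv, zero_dotProduct]
  rw [e1, dotProduct_smul, dotProduct_single, mul_one, smul_eq_mul, mul_eq_zero] at e2
  have hwi : w i = 0 := by simpa [hvi] using e2
  exact ⟨by rw [e1, hwi]; simp, hwi⟩

theorem exists_mulVec_eq_zero_of_det_add_single {K : Type*} [Field K] {A : Matrix ι ι K}
    (hA : A.IsSymm) {i : ι} (h0 : A.det = 0) (h1 : (A + single i i 1).det = 0) :
    ∃ v, v ≠ 0 ∧ A *ᵥ v = 0 ∧ v i = 0 := by
  obtain ⟨v, hv, hAv⟩ := exists_mulVec_eq_zero_iff.mpr h0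
  by_cases hvi : v i = 0
  · exact ⟨v, hv, hAv, hvi⟩
  obtain ⟨w, hw, hAw⟩ := exists_mulVec_eq_zero_iff.mpr h1
  obtain ⟨hw1, hw2⟩ := mulVec_eq_zero_of_add_single hA hAv hvi hAw
  exact ⟨w, hw, hw1, hw2⟩

/-- A symmetric matrix that stays singular when `1` is added to either or both of two diagonal
entries has a nonzero kernel vector vanishing at both places. -/
theorem exists_mulVec_eq_zero_of_det_add_single_add_single {K : Type*} [Field K]
    {A : Matrix ι ι K} (hA : A.IsSymm) {i j : ι} (h0 : A.det = 0)
    (hi : (A + single i i 1).det = 0) (hj : (A + single j j 1).det = 0)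
    (hij : (A + single j j 1 + single i i 1).det = 0) :
    ∃ v, v ≠ 0 ∧ A *ᵥ v = 0 ∧ v i = 0 ∧ v j = 0 := by
  obtain ⟨v, hv, hAv, hvi⟩ := exists_mulVec_eq_zero_of_det_add_single hA h0 hi
  by_cases hvj : v j = 0
  · exact ⟨v, hv, hAv, hvi, hvj⟩
  have hA' : (A + single j j 1).IsSymm := hA.add (by simp [IsSymm])
  obtain ⟨w, hw, hAw, hwi⟩ := exists_mulVec_eq_zero_of_det_add_single hA' hj hij
  obtain ⟨hw1, hw2⟩ := mulVec_eq_zero_of_add_single hA hAv hvj hAw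
  exact ⟨w, hw, hw1, hwi, hw2⟩

end Matrix

/-! ### The expanded Laplacian and its minors -/

section Bordered

variable {E W R : Type*} [DecidableEq E] [CommRing R]

/-- The expanded Laplacian `(diag α, Mᵀ; M, 0)` of the matrix `M` after deletion of the edges `Δ`.
Deleted edges keep their row and column, which are replaced by those of the identity matrix, so
that the index type does not change. -/
def bordered (M : Matrix W E R) (Δ : Finset E) (α : E → R) : Matrix (E ⊕ W) (E ⊕ W) R :=
  fromBlocks (diagonal fun e => if e ∈ Δ then 1 else α e)
    (of fun e w => if e ∈ Δ then 0 else M w e) (of fun w e => if e ∈ Δ then 0 else M w e) 0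

theorem bordered_isSymm (M : Matrix W E R) (Δ : Finset E) (α : E → R) :
    (bordered M Δ α).IsSymm := by
  unfold bordered
  exact IsSymm.fromBlocks (isSymm_diagonal _) rfl (by simp [IsSymm])

variable [DecidableEq W]

theorem bordered_update (M : Matrix W E R) {Δ : Finset E} (α : E → R) {e : E} (he : e ∉ Δ) (a : R) :
    bordered M Δ (Function.update α e a) = (bordered M Δ α).updateRow (Sum.inl e)
      (bordered M Δ α (Sum.inl e) + (a - α e) • Pi.single (Sum.inl e) 1) := by
  ext (x | x) (y | y)
  · by_cases hx : x = e
    · subst hx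
      by_cases hy : y = x
      · subst hy
        simp [bordered, he]
      · simp [bordered, Ne.symm hy, hy]
    · by_cases hy : x = y
      · subst hy
        simp [bordered, hx]
      · simp [bordered, hx, hy]
  · by_cases hx : x = e
    · subst hx
      simp [bordered]
    · simp [bordered, hx]
  all_goals simp [bordered]

theorem bordered_insert (M : Matrix W E R) (Δ : Finset E) (α : E → R) (e : E) :
    bordered M (insert e Δ) α = ((bordered M Δ α).updateRow (Sum.inl e)
      (Pi.single (Sum.inl e) 1)).updateCol (Sum.inl e) (Pi.single (Sum.inl e) 1) := by
  ext (x | x) (y | y)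
  · by_cases hx : x = e <;> by_cases hy : y = e
    · subst hx; subst hy; simp [bordered]
    · subst hx; simp [bordered, hy, Ne.symm hy]
    · subst hy; simp [bordered, hx]
    · by_cases hxy : x = y
      · subst hxy; simp [bordered, hx]
      · simp [bordered, hxy, hx, hy]
  · by_cases hx : x = e
    · subst hx; simp [bordered]
    · simp [bordered, hx]
  · by_cases hy : y = e
    · subst hy; simp [bordered]
    · simp [bordered, hy]
  · simp [bordered]

variable [Fintype E] [Fintype W]

/-- The determinant of the expanded Laplacian of `M` with the edges `Δ` deleted. -/
def borderedDet (M : Matrix W E R) (Δ : Finset E) (α : E → R) : R :=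
  (bordered M Δ α).det

/-- The minor of the expanded Laplacian with the edges `Δ` deleted in which row `i` and column `j`
are removed, with the sign of the cofactor. -/
def borderedMinor (M : Matrix W E R) (Δ : Finset E) (i j : E) (α : E → R) : R :=
  ((bordered M Δ α).updateRow (Sum.inl i) (Pi.single (Sum.inl j) 1)).det

theorem borderedDet_insert (M : Matrix W E R) (Δ : Finset E) (α : E → R) (e : E) :
    borderedDet M (insert e Δ) α =
      ((bordered M Δ α).updateRow (Sum.inl e) (Pi.single (Sum.inl e) 1)).det := by
  rw [borderedDet, bordered_insert, det_updateCol_single_one_of_row_eq]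
  simp

theorem borderedMinor_insert (M : Matrix W E R) (Δ : Finset E) (α : E → R) {e i j : E}
    (hi : e ≠ i) (hj : e ≠ j) : borderedMinor M (insert e Δ) i j α =
      (((bordered M Δ α).updateRow (Sum.inl i) (Pi.single (Sum.inl j) 1)).updateRow (Sum.inl e)
        (Pi.single (Sum.inl e) 1)).det := by
  have hi' : (Sum.inl e : E ⊕ W) ≠ Sum.inl i := by simpa using hi
  have hj' : (Sum.inl e : E ⊕ W) ≠ Sum.inl j := by simpa using hj
  rw [borderedMinor, bordered_insert]
  refine Eq.trans ?_ (det_updateCol_single_one_of_row_eq _ (Sum.inl e) (by simp))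
  congr 1
  ext x y
  simp only [updateRow_apply, updateCol_apply]
  by_cases hx : x = Sum.inl i
  · subst hx
    by_cases hy : y = Sum.inl e
    · subst hy; simp [hi'.symm, hj']
    · simp [hy, hi'.symm]
  · by_cases hx2 : x = Sum.inl e
    · subst hx2; simp [hi]
    · simp [hx, hx2]

/-- The determinant is affine in each variable; the slope is the determinant after deletion. -/
theorem borderedDet_update (M : Matrix W E R) {Δ : Finset E} (α : E → R) {e : E} (he : e ∉ Δ)
    (a : R) : borderedDet M Δ (Function.update α e a) =
      borderedDet M Δ α + (a - α e) * borderedDet M (insert e Δ) α := by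
  rw [borderedDet_insert, borderedDet, bordered_update M α he, det_updateRow_add_smul, borderedDet]

theorem borderedMinor_update (M : Matrix W E R) {Δ : Finset E} (α : E → R) {e i j : E}
    (he : e ∉ Δ) (hi : e ≠ i) (hj : e ≠ j) (a : R) :
    borderedMinor M Δ i j (Function.update α e a) =
      borderedMinor M Δ i j α + (a - α e) * borderedMinor M (insert e Δ) i j α := by
  have hi' : (Sum.inl e : E ⊕ W) ≠ Sum.inl i := by simpa using hi
  rw [borderedMinor_insert M Δ α hi hj, borderedMinor, bordered_update M α he,
    updateRow_comm _ hi', borderedMinor, ← det_updateRow_add_smul, updateRow_ne hi']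

/-- The Dodgson identity `D_i D_j - (C^{i,j})² = D D_{ij}`. -/
theorem borderedDet_mul_sub_sq (M : Matrix W E R) (Δ : Finset E) (α : E → R) {i j : E}
    (hij : i ≠ j) : borderedDet M (insert i Δ) α * borderedDet M (insert j Δ) α -
      borderedMinor M Δ i j α ^ 2 =
        borderedDet M Δ α * borderedDet M (insert j (insert i Δ)) α := by
  have hij' : (Sum.inl i : E ⊕ W) ≠ Sum.inl j := by simpa using hij
  have h := adjugate_minor (bordered M Δ α) hij'
  have hs := (bordered_isSymm M Δ α).adjugate.apply (Sum.inl i) (Sum.inl j)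
  rw [← hs, adjugate_apply, adjugate_apply, adjugate_apply, ← borderedDet_insert,
    ← borderedDet_insert, ← borderedMinor, ← pow_two] at h
  rw [h, borderedDet, borderedDet_insert M (insert i Δ), bordered_insert]
  congr 1
  rw [← det_updateCol_single_one_of_row_eq _ (Sum.inl i) (by simp [hij])]
  congr 1
  ext x y
  simp only [updateRow_apply, updateCol_apply]
  by_cases hx : x = Sum.inl j
  · subst hx
    by_cases hy : y = Sum.inl i
    · subst hy; simp [hij, hij.symm]
    · simp [hy]
  · simp [hx]

theorem map_borderedDet {S : Type*} [CommRing S] (f : R →+* S) (M : Matrix W E R) (Δ : Finset E)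
    (α : E → R) : f (borderedDet M Δ α) = borderedDet (M.map f) Δ (f ∘ α) := by
  rw [borderedDet, f.map_det, borderedDet]
  congr 1
  ext (x | x) (y | y)
  · by_cases h : x = y
    · subst h
      by_cases hx : x ∈ Δ <;> simp [bordered, hx]
    · simp [bordered, h]
  · by_cases hx : x ∈ Δ <;> simp [bordered, hx]
  · by_cases hx : y ∈ Δ <;> simp [bordered, hx]
  · simp [bordered]

theorem map_borderedMinor {S : Type*} [CommRing S] (f : R →+* S) (M : Matrix W E R) (Δ : Finset E)
    (i j : E) (α : E → R) :
    f (borderedMinor M Δ i j α) = borderedMinor (M.map f) Δ i j (f ∘ α) := by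
  rw [borderedMinor, f.map_det, borderedMinor]
  congr 1
  ext x y
  by_cases hx : x = Sum.inl i
  · subst hx
    by_cases hy : y = Sum.inl j
    · subst hy; simp
    · simp [hy]
  · rw [RingHom.mapMatrix_apply, map_apply, updateRow_ne hx, updateRow_ne hx]
    rcases x with x | x <;> rcases y with y | y
    · by_cases h : x = y
      · subst h
        by_cases hx : x ∈ Δ <;> simp [bordered, hx]
      · simp [bordered, h]
    · by_cases hx : x ∈ Δ <;> simp [bordered, hx]
    · by_cases hx : y ∈ Δ <;> simp [bordered, hx]
    · simp [bordered]

end Bordered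

section Degree

theorem sum_ite_mem_zero_one {E : Type*} [DecidableEq E] [Fintype E] (Δ : Finset E) :
    ∑ e : E, (if e ∈ Δ then (0 : ℤ) else 1) = Fintype.card E - Δ.card := by
  have h : ({e | e ∉ Δ} : Finset E) = Δᶜ := by ext; simp
  rw [Finset.sum_ite, Finset.sum_const_zero, zero_add, Finset.sum_const, h, nsmul_eq_mul, mul_one,
    Finset.card_compl, Nat.cast_sub (Finset.card_le_univ Δ)]

theorem totalDegree_bordered_le {E W σ R : Type*} [DecidableEq E] [CommRing R]
    (M : Matrix W E R) (Δ : Finset E) (α : E → MvPolynomial σ R)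
    (hα : ∀ e, (α e).totalDegree ≤ 1) (x y : E ⊕ W) (h : bordered (M.map C) Δ α x y ≠ 0) :
    ((bordered (M.map C) Δ α x y).totalDegree : ℤ) ≤
      Sum.elim (fun e => if e ∈ Δ then 0 else 1) (fun _ => 0) x +
        Sum.elim (fun _ => 0) (fun _ => -1) y := by
  rcases x with x | x <;> rcases y with y | y
  · by_cases hxy : x = y
    · subst hxy
      by_cases hx : x ∈ Δ
      · simp [bordered, hx]
      · simpa [bordered, hx] using hα x
    · simp [bordered, hxy] at h
  · by_cases hx : x ∈ Δ
    · simp [bordered, hx] at h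
    · simp [bordered, hx]
  · by_cases hy : y ∈ Δ
    · simp [bordered, hy] at h
    · simp [bordered, hy]
  · simp [bordered] at h

variable {E W σ R : Type*} [DecidableEq E] [Fintype E] [DecidableEq W] [Fintype W] [CommRing R]

/-- The degree is at most the number of remaining edges minus the number of rows of `M`. Entries in
the columns of the border get weight `-1`, as each of them uses up the row of an edge. -/
theorem totalDegree_borderedDet_le (M : Matrix W E R) (Δ : Finset E) (α : E → MvPolynomial σ R)
    (hα : ∀ e, (α e).totalDegree ≤ 1) (h : borderedDet (M.map C) Δ α ≠ 0) :
    (borderedDet (M.map C) Δ α).totalDegree + Δ.card + Fintype.card W ≤ Fintype.card E := by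
  have := totalDegree_det_le _ _ _ (totalDegree_bordered_le M Δ α hα) h
  have h2 : ∑ e : E, (if e ∈ Δ then (0 : ℤ) else 1) = Fintype.card E - Δ.card := by
    exact sum_ite_mem_zero_one _
  simp only [Fintype.sum_sum_type, Sum.elim_inl, Sum.elim_inr, h2] at this
  simp at this
  rw [borderedDet]
  omega

theorem totalDegree_borderedMinor_le (M : Matrix W E R) (Δ : Finset E) {i : E} (j : E)
    (hi : i ∉ Δ) (α : E → MvPolynomial σ R)
    (hα : ∀ e, (α e).totalDegree ≤ 1) (h : borderedMinor (M.map C) Δ i j α ≠ 0) :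
    (borderedMinor (M.map C) Δ i j α).totalDegree + Δ.card + Fintype.card W + 1
      ≤ Fintype.card E := by
  have := totalDegree_det_le _
    (Sum.elim (fun e => if e ∈ insert i Δ then 0 else 1) (fun _ => 0))
    (Sum.elim (fun _ => 0) (fun _ => -1)) (fun x y hxy => ?_) h
  · have h2 : ∑ e : E, (if e ∈ insert i Δ then (0 : ℤ) else 1) =
        Fintype.card E - (insert i Δ).card := by
      exact sum_ite_mem_zero_one _
    rw [Finset.card_insert_of_notMem hi] at h2
    simp only [Fintype.sum_sum_type, Sum.elim_inl, Sum.elim_inr, h2] at this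
    simp at this
    rw [borderedMinor]
    omega
  · by_cases hx : x = Sum.inl i
    · subst hx
      by_cases hy : y = Sum.inl j
      · subst hy; simp
      · simp [hy] at hxy
    · rw [updateRow_ne hx] at hxy ⊢
      refine (totalDegree_bordered_le M Δ α hα x y hxy).trans (le_of_eq ?_)
      rcases x with x | x
      · have : x ≠ i := by simpa using hx
        simp [this]
      · simp

end Degree

/-! ### Sums and zeros on coordinate subspaces over a finite field -/

section ZeroOn

variable {E F : Type*} [Fintype E] [DecidableEq E] [Field F] [Fintype F] [DecidableEq F]

variable (F) in
/-- The points of `F^E` whose coordinates in `s` are zero. It serves as the affine space with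
coordinates outside `s`, while all polynomials stay functions on `E → F`. -/
def zeroOn (s : Finset E) : Finset (E → F) :=
  {α | ∀ e ∈ s, α e = 0}

@[simp]
theorem mem_zeroOn {s : Finset E} {α : E → F} : α ∈ zeroOn F s ↔ ∀ e ∈ s, α e = 0 := by
  simp [zeroOn]

theorem sum_zeroOn_eq_sum_insert {A : Type*} [AddCommMonoid A] {s : Finset E} {e : E} (he : e ∉ s)
    (φ : (E → F) → A) : ∑ α ∈ zeroOn F s, φ α =
      ∑ α ∈ zeroOn F (insert e s), ∑ a, φ (Function.update α e a) := by
  rw [← Finset.sum_product']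
  symm
  refine Finset.sum_bij' (fun x _ => Function.update x.1 e x.2)
    (fun α _ => (Function.update α e 0, α e)) ?_ ?_ ?_ ?_ ?_
  · rintro ⟨α, a⟩ h
    simp only [Finset.mem_product, mem_zeroOn, Finset.mem_univ, and_true] at h ⊢
    intro x hx
    rw [Function.update_of_ne (by rintro rfl; exact he hx)]
    exact h x (Finset.mem_insert_of_mem hx)
  · intro α h
    simp only [Finset.mem_product, mem_zeroOn, Finset.mem_univ, and_true] at h ⊢
    intro x hx
    by_cases hxe : x = e
    · subst hxe; simp
    · rw [Function.update_of_ne hxe]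
      exact h x ((Finset.mem_insert.mp hx).resolve_left hxe)
  · rintro ⟨α, a⟩ h
    simp only [Finset.mem_product, mem_zeroOn, Finset.mem_univ, and_true] at h
    have := h e (Finset.mem_insert_self e s)
    simp only [Function.update_idem, Function.update_self, Prod.mk.injEq, and_true]
    rw [← this, Function.update_eq_self]
  · intro α h
    simp
  · simp

theorem card_zeroOn_mul (s : Finset E) :
    (zeroOn F s).card * Fintype.card F ^ s.card = Fintype.card F ^ Fintype.card E := by
  induction s using Finset.induction_on with
  | empty => simp [zeroOn]
  | insert e s he ih =>
    rw [← ih, Finset.card_insert_of_notMem he, Finset.card_eq_sum_ones (zeroOn F s),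
      sum_zeroOn_eq_sum_insert he]
    simp [pow_succ]
    ring

theorem card_zeroOn (s : Finset E) :
    (zeroOn F s).card = Fintype.card F ^ (Fintype.card E - s.card) := by
  have h := card_zeroOn_mul (F := F) s
  have h2 := Finset.card_le_univ s
  rw [← Nat.sub_add_cancel h2, pow_add] at h
  exact Nat.eq_of_mul_eq_mul_right (pow_pos Fintype.card_pos _) h

/-- The Chevalley–Warning vanishing for the coordinate subspace `zeroOn F s`. Its indicator function
is the polynomial `∏ e ∈ s, (1 - X e ^ (q - 1))`. -/
theorem sum_zeroOn_eval_eq_zero (s : Finset E) (P : MvPolynomial E F)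
    (h : P.totalDegree < (Fintype.card F - 1) * (Fintype.card E - s.card)) :
    ∑ α ∈ zeroOn F s, eval α P = 0 := by
  have hq : 0 < Fintype.card F - 1 := Nat.sub_pos_of_lt Fintype.one_lt_card
  have h1 : ∑ α : E → F, eval α (P * ∏ e ∈ s, (1 - X e ^ (Fintype.card F - 1))) = 0 := by
    refine MvPolynomial.sum_eval_eq_zero _ ?_
    have h2 : (∏ e ∈ s, (1 - X e ^ (Fintype.card F - 1)) : MvPolynomial E F).totalDegree ≤
        (Fintype.card F - 1) * s.card := by
      refine (totalDegree_finsetProd _ _).trans ?_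
      rw [mul_comm, ← smul_eq_mul]
      refine Finset.sum_le_card_nsmul _ _ _ fun e _ => ?_
      refine (totalDegree_sub _ _).trans ?_
      rw [totalDegree_one, totalDegree_X_pow]
      simp
    refine (totalDegree_mul _ _).trans_lt ?_
    calc _ < (Fintype.card F - 1) * (Fintype.card E - s.card) +
          (Fintype.card F - 1) * s.card := by omega
      _ = _ := by rw [← mul_add, Nat.sub_add_cancel (Finset.card_le_univ s)]
  rw [← h1, zeroOn, Finset.sum_filter]
  refine Finset.sum_congr rfl fun α _ => ?_
  rw [map_mul, map_prod]
  simp only [map_sub, map_one, map_pow, eval_X]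
  split_ifs with hα
  · rw [Finset.prod_eq_one, mul_one]
    intro e he
    rw [hα e he, zero_pow hq.ne', sub_zero]
  · push Not at hα
    obtain ⟨e, he, hne⟩ := hα
    rw [Finset.prod_eq_zero he, mul_zero]
    rw [FiniteField.pow_card_sub_one_eq_one _ hne, sub_self]

/-- The number of zeros of `φ` on `zeroOn F s`. -/
def numZeros (s : Finset E) (φ : (E → F) → F) : ℤ :=
  ∑ α ∈ zeroOn F s, if φ α = 0 then 1 else 0

theorem numZeros_zero (s : Finset E) :
    numZeros s (fun _ => (0 : F)) = Fintype.card F ^ (Fintype.card E - s.card) := by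
  simp [numZeros, card_zeroOn]

theorem numZeros_const (s : Finset E) (c : F) (m : ℤ)
    (hm : m ∣ Fintype.card F ^ (Fintype.card E - s.card)) : m ∣ numZeros s (fun _ => c) := by
  by_cases hc : c = 0
  · rw [hc, numZeros_zero]
    exact hm
  · simp [numZeros, hc]

theorem ite_eq_zero_eq_one_sub_pow (x : F) :
    (if x = 0 then 1 else 0 : F) = 1 - x ^ (Fintype.card F - 1) := by
  have hq : 0 < Fintype.card F - 1 := Nat.sub_pos_of_lt Fintype.one_lt_card
  split_ifs with h
  · rw [h, zero_pow hq.ne', sub_zero]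
  · rw [FiniteField.pow_card_sub_one_eq_one _ h, sub_self]

variable (p : ℕ) [CharP F p]

theorem dvd_card_of_charP (F : Type*) [Field F] [Fintype F] (p : ℕ) [CharP F p] :
    (p : ℤ) ∣ Fintype.card F := by
  rw [← CharP.intCast_eq_zero_iff F p]
  simp

theorem dvd_numZeros_of_totalDegree_lt (s : Finset E) (P : MvPolynomial E F)
    (h : P.totalDegree < Fintype.card E - s.card) : (p : ℤ) ∣ numZeros s (fun α => eval α P) := by
  have hq : 0 < Fintype.card F - 1 := Nat.sub_pos_of_lt Fintype.one_lt_card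
  rw [← CharP.intCast_eq_zero_iff F p, numZeros]
  push_cast
  rw [Finset.sum_congr rfl fun α _ => ite_eq_zero_eq_one_sub_pow (eval α P)]
  rw [← sum_zeroOn_eval_eq_zero s (1 - P ^ (Fintype.card F - 1))]
  · simp
  · refine (totalDegree_sub _ _).trans_lt ?_
    rw [totalDegree_one, Nat.zero_max]
    exact (totalDegree_pow _ _).trans_lt (Nat.mul_lt_mul_of_pos_left h hq)

end ZeroOn

section Affine

variable {F : Type*} [Field F] [Fintype F] [DecidableEq F]

/-- The number of zeros of the affine function `a ↦ f + a * g`. -/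
theorem sum_affine_eq_zero (f g : F) :
    ∑ a : F, (if f + a * g = 0 then 1 else 0 : ℤ) =
      Fintype.card F * (if f = 0 ∧ g = 0 then 1 else 0) + 1 - (if g = 0 then 1 else 0) := by
  by_cases hg : g = 0
  · subst hg
    by_cases hf : f = 0 <;> simp [hf]
  · have : ∀ a : F, f + a * g = 0 ↔ a = - f / g := by
      intro a
      rw [eq_div_iff hg]
      constructor <;> intro h <;> linear_combination h
    simp [this, hg]

/-- The number of common zeros of two affine functions whose resultant is the square `s ^ 2`. -/
theorem sum_affine_affine_eq_zero {d u v m s : F} (h : u * v - s ^ 2 = d * m) :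
    ∑ a : F, (if d + a * u = 0 ∧ v + a * m = 0 then 1 else 0 : ℤ) =
      Fintype.card F * (if d = 0 ∧ u = 0 ∧ v = 0 ∧ m = 0 then 1 else 0) +
        (if s = 0 then 1 else 0) - (if u = 0 ∧ m = 0 then 1 else 0) := by
  by_cases hm : m = 0
  · subst hm
    by_cases hu : u = 0
    · subst hu
      have hs : s = 0 := by
        rw [← sq_eq_zero_iff]; linear_combination - h
      subst hs
      by_cases hd : d = 0 <;> by_cases hv : v = 0 <;> simp [hd, hv]
    · have hsv : v = 0 ↔ s = 0 := by
        constructor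
        · intro hv
          rw [← sq_eq_zero_iff]; linear_combination - h + u * hv
        · intro hs
          have : u * v = 0 := by linear_combination h + s * hs
          exact (mul_eq_zero.mp this).resolve_left hu
      have : ∀ a : F, d + a * u = 0 ↔ a = - d / u := by
        intro a
        rw [eq_div_iff hu]
        constructor <;> intro h <;> linear_combination h
      simp [this, hu, hsv, ite_and]
  · have h1 : ∀ a : F, v + a * m = 0 ↔ a = - v / m := by
      intro a
      rw [eq_div_iff hm]
      constructor <;> intro h <;> linear_combination h
    have h2 : d + - v / m * u = 0 ↔ s = 0 := by
      rw [← sq_eq_zero_iff (a := s)]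
      constructor
      · intro h3
        field_simp at h3
        linear_combination - h - h3
      · intro h3
        field_simp
        linear_combination - h - h3
    simp only [h1, hm, and_false, if_false, mul_zero, zero_add, sub_zero]
    rw [Finset.sum_eq_single (- v / m)]
    · simp [h2]
    · intro b _ hb
      simp [hb]
    · simp

/-- The number of zeros of `d + a u + b v + a b m` in the plane, if `u v - d m` is the square
`s ^ 2`. -/
theorem sum_sum_biaffine_eq_zero {d u v m s : F} (h : u * v - s ^ 2 = d * m) :
    ∑ a : F, ∑ b : F, (if d + a * u + b * (v + a * m) = 0 then 1 else 0 : ℤ) =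
      (Fintype.card F : ℤ) ^ 2 * (if d = 0 ∧ u = 0 ∧ v = 0 ∧ m = 0 then 1 else 0) +
        Fintype.card F * (if s = 0 then 1 else 0) + Fintype.card F + 1 -
        ∑ a : F, (if v + a * m = 0 then 1 else 0) - ∑ b : F, (if u + b * m = 0 then 1 else 0) -
        (if m = 0 then 1 else 0) := by
  simp only [fun a : F => sum_affine_eq_zero (d + a * u) (v + a * m), Finset.sum_sub_distrib,
    Finset.sum_add_distrib, ← Finset.mul_sum, sum_affine_affine_eq_zero h, sum_affine_eq_zero u m,
    Finset.sum_const, Finset.card_univ, nsmul_eq_mul]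
  ring

end Affine

/-! ### Simultaneous vanishing for two edges -/

section FourVanish

variable {F : Type*} [Field F]

theorem sum_boole_eq_card_submodule {V : Type*} [AddCommGroup V] [Module F V] [Fintype V]
    (P : V → Prop) [DecidablePred P] (U : Submodule F V) (h : ∀ v, P v ↔ v ∈ U) :
    ∑ v, (if P v then 1 else 0 : F) = Nat.card U := by
  classical
  rw [Finset.sum_boole, Nat.card_eq_fintype_card, Fintype.card_subtype]
  simp only [h]

theorem natCast_card_submodule [Fintype F] {V : Type*} [AddCommGroup V] [Module F V] [Finite V]
    (U : Submodule F V) : (Nat.card U : F) = open Classical in if U = ⊥ then 1 else 0 := by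
  have : Module.Finite F V := Module.Finite.of_finite
  rw [Module.natCard_eq_pow_finrank (K := F) (V := U), Nat.card_eq_fintype_card, Nat.cast_pow,
    FiniteField.cast_card_eq_zero]
  split_ifs with h
  · subst h; simp
  · rw [zero_pow]
    exact fun h0 => h (Submodule.finrank_eq_zero.mp h0)

theorem bordered_update_eq_add_single {E W : Type*} [DecidableEq E] [DecidableEq W]
    (M : Matrix W E F) {Δ : Finset E} (α : E → F) {e : E} (he : e ∉ Δ) (h0 : α e = 0) :
    bordered M Δ (Function.update α e 1) =
      bordered M Δ α + single (Sum.inl e) (Sum.inl e) 1 := by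
  rw [bordered_update M α he, h0, sub_zero, one_smul]
  ext x y
  by_cases hx : x = Sum.inl e
  · subst hx
    simp [single_apply, Pi.single_apply, eq_comm]
  · simp [hx, Ne.symm hx]

variable {E W : Type*} [Fintype E] [DecidableEq E] [Fintype W]

/-- Kernel vectors `(r, φ)` of the expanded Laplacian that vanish on the edges `i`, `j`: `r` is a
cycle, and `α r` is, up to sign, the cut `φᵀ M`. -/
theorem bordered_mulVec_eq_zero_iff (M : Matrix W E F) {Δ : Finset E} {i j : E}
    {α : E → F} (r : E → F) (φ : W → F) :
    (bordered M Δ α *ᵥ Sum.elim r φ = 0 ∧ r i = 0 ∧ r j = 0) ↔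
      (∀ e ∉ Δ, α e * r e + (φ ᵥ* M) e = 0) ∧ (∀ e ∈ insert j (insert i Δ), r e = 0) ∧
        M *ᵥ r = 0 := by
  have hE : ∀ e, (bordered M Δ α *ᵥ Sum.elim r φ) (Sum.inl e) =
      if e ∈ Δ then r e else α e * r e + (φ ᵥ* M) e := by
    intro e
    rw [bordered, fromBlocks_mulVec, Sum.elim_inl, Pi.add_apply, mulVec_diagonal]
    split_ifs with he <;>
      simp [he, mulVec, vecMul, dotProduct, mul_comm]
  have hW : ∀ w, (bordered M Δ α *ᵥ Sum.elim r φ) (Sum.inr w) =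
      ∑ e, if e ∈ Δ then 0 else M w e * r e := by
    intro w
    rw [bordered, fromBlocks_mulVec, Sum.elim_inr]
    simp [mulVec, dotProduct]
  have hM : (∀ e ∈ Δ, r e = 0) → ∀ w, (∑ e, if e ∈ Δ then 0 else M w e * r e) = (M *ᵥ r) w := by
    intro h w
    refine Finset.sum_congr rfl fun e _ => ?_
    split_ifs with he
    · rw [h e he, mul_zero]
    · rfl
  constructor
  · rintro ⟨h, hri, hrj⟩
    have hΔ : ∀ e ∈ Δ, r e = 0 := by
      intro e he
      have := congrFun h (Sum.inl e)
      rw [hE, if_pos he] at this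
      exact this
    refine ⟨fun e he => ?_, fun e he => ?_, ?_⟩
    · have := congrFun h (Sum.inl e)
      rw [hE, if_neg he] at this
      exact this
    · rw [Finset.mem_insert, Finset.mem_insert] at he
      rcases he with rfl | rfl | he
      exacts [hrj, hri, hΔ e he]
    · ext w
      rw [← hM hΔ, ← hW, h]
      rfl
  · rintro ⟨h1, h2, h3⟩
    have hΔ : ∀ e ∈ Δ, r e = 0 := fun e he => h2 e (by simp [he])
    refine ⟨?_, h2 i (by simp), h2 j (by simp)⟩
    ext (e | w)
    · rw [hE]
      split_ifs with he
      exacts [hΔ e he, h1 e he]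
    · rw [hW, hM hΔ, h3]
      rfl

variable [DecidableEq W]

theorem borderedDet_four_eq_zero_iff (M : Matrix W E F) {Δ : Finset E} {i j : E} (hij : i ≠ j)
    (hi : i ∉ Δ) (hj : j ∉ Δ) {α : E → F} (h0i : α i = 0) (h0j : α j = 0) :
    (borderedDet M Δ α = 0 ∧ borderedDet M (insert i Δ) α = 0 ∧ borderedDet M (insert j Δ) α = 0 ∧
      borderedDet M (insert j (insert i Δ)) α = 0) ↔
    ∃ v : E ⊕ W → F, v ≠ 0 ∧ bordered M Δ α *ᵥ v = 0 ∧ v (Sum.inl i) = 0 ∧ v (Sum.inl j) = 0 := by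
  have hA := bordered_update_eq_add_single M α hi h0i
  have hB := bordered_update_eq_add_single M α hj h0j
  have hAB := bordered_update_eq_add_single M (Function.update α j 1) hi (by simp [hij, h0i])
  have dA := borderedDet_update M α hi 1
  have dB := borderedDet_update M α hj 1
  have dAB := borderedDet_update M (Function.update α j 1) hi 1
  have hj' : j ∉ insert i Δ := by simp [hij.symm, hj]
  have dm := borderedDet_update M α hj' 1
  rw [dB, dm, Function.update_of_ne hij, h0i, h0j] at dAB
  rw [h0i] at dA
  rw [h0j] at dB
  rw [borderedDet, hA] at dA
  rw [borderedDet, hB] at dB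
  rw [borderedDet, hAB, hB] at dAB
  constructor
  · rintro ⟨h1, h2, h3, h4⟩
    rw [h1, h2] at dA
    rw [h1, h3] at dB
    rw [h1, h2, h3, h4] at dAB
    exact exists_mulVec_eq_zero_of_det_add_single_add_single (bordered_isSymm M Δ α) h1
      (by simpa using dA) (by simpa using dB) (by simpa using dAB)
  · rintro ⟨v, hv, hAv, hvi, hvj⟩
    have e0 : (bordered M Δ α).det = 0 := exists_mulVec_eq_zero_iff.mp ⟨v, hv, hAv⟩
    have eA : (bordered M Δ α + single (Sum.inl i) (Sum.inl i) 1).det = 0 :=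
      exists_mulVec_eq_zero_iff.mp ⟨v, hv, by simp [add_mulVec, hAv, single_mulVec, hvi]⟩
    have eB : (bordered M Δ α + single (Sum.inl j) (Sum.inl j) 1).det = 0 :=
      exists_mulVec_eq_zero_iff.mp ⟨v, hv, by simp [add_mulVec, hAv, single_mulVec, hvj]⟩
    have eAB : (bordered M Δ α + single (Sum.inl j) (Sum.inl j) 1 +
        single (Sum.inl i) (Sum.inl i) 1).det = 0 :=
      exists_mulVec_eq_zero_iff.mp
        ⟨v, hv, by simp [add_mulVec, hAv, single_mulVec, hvi, hvj]⟩
    have e0' : borderedDet M Δ α = 0 := e0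
    have h2 : borderedDet M (insert i Δ) α = 0 := by linear_combination eA - dA - e0'
    have h3 : borderedDet M (insert j Δ) α = 0 := by linear_combination eB - dB - e0'
    refine ⟨e0', h2, h3, ?_⟩
    linear_combination eAB - dAB - e0' - h2 - h3

variable [Fintype F] [DecidableEq F]

/-- The number of pairs of a point `α` and a kernel vector `(r, φ)` is zero in `F`. If `r` vanishes
at a free edge `e`, then `α e` is arbitrary. Otherwise `α` is determined by `(r, φ)`, and `φ` runs over
the subspace given by the two equations `(φᵀ M) i = (φᵀ M) j = 0`, which is nonzero for `3 ≤ |W|`. -/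
theorem sum_zeroOn_ker_eq_zero (M : Matrix W E F) {Δ : Finset E} {i j : E}
    (hi : i ∉ Δ) (hj : j ∉ Δ) (hW : 3 ≤ Fintype.card W) :
    ∑ α ∈ zeroOn F (insert j (insert i Δ)), ∑ r : E → F, ∑ φ : W → F,
      (if (∀ e ∉ Δ, α e * r e + (φ ᵥ* M) e = 0) ∧ (∀ e ∈ insert j (insert i Δ), r e = 0) ∧
        M *ᵥ r = 0 then 1 else 0 : F) = 0 := by
  set s := insert j (insert i Δ) with hs
  rw [Finset.sum_comm]
  refine Finset.sum_eq_zero fun r _ => ?_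
  rw [Finset.sum_comm]
  by_cases hr : ∃ e, e ∉ s ∧ r e = 0
  · obtain ⟨e, hes, hre⟩ := hr
    refine Finset.sum_eq_zero fun φ _ => ?_
    rw [sum_zeroOn_eq_sum_insert hes]
    refine Finset.sum_eq_zero fun α _ => ?_
    have : ∀ a x, Function.update α e a x * r x = α x * r x := by
      intro a x
      by_cases hx : x = e
      · subst hx; simp [hre]
      · simp [hx]
    simp only [this]
    simp
  · push Not at hr
    by_cases hrs : (∀ e ∈ s, r e = 0) ∧ M *ᵥ r = 0
    · let L : (W → F) →ₗ[F] (Fin 2 → F) :=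
        { toFun := fun φ => ![(φ ᵥ* M) i, (φ ᵥ* M) j]
          map_add' := by intro a b; ext k; fin_cases k <;> simp [add_vecMul]
          map_smul' := by intro a b; ext k; fin_cases k <;> simp [smul_vecMul] }
      have hL : LinearMap.ker L ≠ ⊥ := by
        apply LinearMap.ker_ne_bot_of_finrank_lt
        simp
        omega
      have hsum : ∀ φ : W → F, ∑ α ∈ zeroOn F s,
          (if (∀ e ∉ Δ, α e * r e + (φ ᵥ* M) e = 0) ∧ (∀ e ∈ s, r e = 0) ∧ M *ᵥ r = 0
            then 1 else 0 : F) = if (φ ᵥ* M) i = 0 ∧ (φ ᵥ* M) j = 0 then 1 else 0 := by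
        intro φ
        rw [Finset.sum_boole]
        have hφ : ∀ α ∈ zeroOn F s, ((∀ e ∉ Δ, α e * r e + (φ ᵥ* M) e = 0) ∧
            (∀ e ∈ s, r e = 0) ∧ M *ᵥ r = 0) ↔ (((φ ᵥ* M) i = 0 ∧ (φ ᵥ* M) j = 0) ∧
              α = fun e => if e ∈ s then 0 else - (φ ᵥ* M) e / r e) := by
          intro α hα
          rw [mem_zeroOn] at hα
          constructor
          · rintro ⟨h, -⟩
            refine ⟨⟨?_, ?_⟩, ?_⟩
            · simpa [hα i (by simp [hs])] using h i hi
            · simpa [hα j (by simp [hs])] using h j hj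
            · ext e
              split_ifs with he
              · exact hα e he
              · have := h e fun h => he (by simp [hs, h])
                rw [eq_div_iff (hr e he)]
                linear_combination this
          · rintro ⟨⟨h1, h2⟩, h3⟩
            refine ⟨fun e he => ?_, hrs⟩
            by_cases hes : e ∈ s
            · rw [hα e hes, zero_mul, zero_add]
              rw [hs, Finset.mem_insert, Finset.mem_insert] at hes
              rcases hes with rfl | rfl | hes
              exacts [h2, h1, absurd hes he]
            · rw [h3]
              simp [hes, hr e hes]
        rw [Finset.filter_congr hφ]
        split_ifs with hc
        · have : {α ∈ zeroOn F s | ((φ ᵥ* M) i = 0 ∧ (φ ᵥ* M) j = 0) ∧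
              α = fun e => if e ∈ s then 0 else - (φ ᵥ* M) e / r e} =
              {fun e => if e ∈ s then 0 else - (φ ᵥ* M) e / r e} := by
            ext α
            simp only [Finset.mem_filter, hc, and_self, true_and, Finset.mem_singleton,
              and_iff_right_iff_imp]
            rintro rfl
            rw [mem_zeroOn]
            intro e he
            simp [he]
          rw [this]
          simp
        · simp [hc]
      rw [Finset.sum_congr rfl fun φ _ => hsum φ,
        sum_boole_eq_card_submodule _ (LinearMap.ker L) fun φ => ?_,
        natCast_card_submodule, if_neg hL]
      rw [LinearMap.mem_ker]
      simp [L]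
    · refine Finset.sum_eq_zero fun φ _ => Finset.sum_eq_zero fun α _ => ?_
      rw [if_neg]
      exact fun h => hrs h.2

/-- The number of points where `D`, `D_i`, `D_j` and `D_{ij}` all vanish is divisible by `p`. At each
point the kernel vectors vanishing at `i` and `j` form a vector space, of size `1` in `F` if it is
trivial and `0` otherwise. -/
theorem dvd_sum_zeroOn_four (p : ℕ) [CharP F p] (M : Matrix W E F) {Δ : Finset E} {i j : E}
    (hij : i ≠ j) (hi : i ∉ Δ) (hj : j ∉ Δ) (hW : 3 ≤ Fintype.card W)
    (hE : Δ.card + 2 < Fintype.card E) :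
    (p : ℤ) ∣ ∑ α ∈ zeroOn F (insert j (insert i Δ)),
      if borderedDet M Δ α = 0 ∧ borderedDet M (insert i Δ) α = 0 ∧
        borderedDet M (insert j Δ) α = 0 ∧ borderedDet M (insert j (insert i Δ)) α = 0
        then 1 else 0 := by
  rw [← CharP.intCast_eq_zero_iff F p]
  push_cast
  have key : ∀ α ∈ zeroOn F (insert j (insert i Δ)),
      (if borderedDet M Δ α = 0 ∧ borderedDet M (insert i Δ) α = 0 ∧
        borderedDet M (insert j Δ) α = 0 ∧ borderedDet M (insert j (insert i Δ)) α = 0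
        then 1 else 0 : F) = 1 - ∑ r : E → F, ∑ φ : W → F,
      (if (∀ e ∉ Δ, α e * r e + (φ ᵥ* M) e = 0) ∧ (∀ e ∈ insert j (insert i Δ), r e = 0) ∧
        M *ᵥ r = 0 then 1 else 0 : F) := by
    intro α hα
    rw [mem_zeroOn] at hα
    have h0i : α i = 0 := hα i (by simp)
    have h0j : α j = 0 := hα j (by simp)
    let U : Submodule F (E ⊕ W → F) :=
      { carrier := {v | bordered M Δ α *ᵥ v = 0 ∧ v (Sum.inl i) = 0 ∧ v (Sum.inl j) = 0}
        add_mem' := by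
          rintro a b ⟨h1, h2, h3⟩ ⟨h4, h5, h6⟩
          exact ⟨by rw [mulVec_add, h1, h4, add_zero], by simp [h2, h5], by simp [h3, h6]⟩
        zero_mem' := by simp
        smul_mem' := by
          rintro c a ⟨h1, h2, h3⟩
          exact ⟨by rw [mulVec_smul, h1, smul_zero], by simp [h2], by simp [h3]⟩ }
    have hU : (∑ r : E → F, ∑ φ : W → F,
      (if (∀ e ∉ Δ, α e * r e + (φ ᵥ* M) e = 0) ∧ (∀ e ∈ insert j (insert i Δ), r e = 0) ∧
        M *ᵥ r = 0 then 1 else 0 : F)) = (Nat.card U : F) := by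
      simp only [← bordered_mulVec_eq_zero_iff M]
      rw [← Fintype.sum_prod_type' (f := fun (r : E → F) (φ : W → F) =>
        (if bordered M Δ α *ᵥ Sum.elim r φ = 0 ∧ r i = 0 ∧ r j = 0 then 1 else 0 : F)),
        ← (Equiv.sumArrowEquivProdArrow E W F).sum_comp]
      refine sum_boole_eq_card_submodule _ U fun v => ?_
      have : Sum.elim (v ∘ Sum.inl) (v ∘ Sum.inr) = v := Sum.elim_comp_inl_inr v
      simp [U, Equiv.sumArrowEquivProdArrow, this]
    rw [hU, natCast_card_submodule]
    have hbot : (borderedDet M Δ α = 0 ∧ borderedDet M (insert i Δ) α = 0 ∧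
        borderedDet M (insert j Δ) α = 0 ∧ borderedDet M (insert j (insert i Δ)) α = 0) ↔
        U ≠ ⊥ := by
      rw [borderedDet_four_eq_zero_iff M hij hi hj h0i h0j, Submodule.ne_bot_iff]
      constructor
      · rintro ⟨v, h1, h2⟩; exact ⟨v, h2, h1⟩
      · rintro ⟨v, h2, h1⟩; exact ⟨v, h1, h2⟩
    simp only [hbot]
    by_cases hb : U = ⊥ <;> simp [hb]
  rw [Finset.sum_congr rfl key, Finset.sum_sub_distrib, sum_zeroOn_ker_eq_zero M hi hj hW]
  have hc : (insert j (insert i Δ)).card = Δ.card + 2 := by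
    rw [Finset.card_insert_of_notMem (by simp [hij.symm, hj]), Finset.card_insert_of_notMem hi]
  rw [Finset.sum_const, card_zeroOn, hc, sub_zero, nsmul_eq_mul, Nat.cast_pow,
    FiniteField.cast_card_eq_zero, zero_pow (by omega), zero_mul]

end FourVanish

/-! ### Counting zeros of the determinant modulo `p q²` -/

section CountModP

variable {F : Type*} [Field F] {E W : Type*} [Fintype E] [DecidableEq E] [Fintype W]
  [DecidableEq W]

theorem eval_borderedDet (M : Matrix W E F) (Δ : Finset E) (α : E → F) :
    eval α (borderedDet (M.map C) Δ X) = borderedDet M Δ α := by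
  rw [map_borderedDet]
  congr 1
  · ext; simp
  · ext; simp

theorem eval_borderedMinor (M : Matrix W E F) (Δ : Finset E) (i j : E) (α : E → F) :
    eval α (borderedMinor (M.map C) Δ i j X) = borderedMinor M Δ i j α := by
  rw [map_borderedMinor]
  congr 1
  · ext; simp
  · ext; simp

theorem borderedDet_eq_const (M : Matrix W E F) (Δ : Finset E)
    (h : Fintype.card E ≤ Δ.card + Fintype.card W) : ∃ c, ∀ α, borderedDet M Δ α = c := by
  by_cases h0 : borderedDet (M.map (C (σ := E))) Δ X = 0
  · exact ⟨0, fun α => by rw [← eval_borderedDet, h0, map_zero]⟩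
  · have := totalDegree_borderedDet_le M Δ X (fun e => (totalDegree_X e).le) h0
    have h1 := totalDegree_eq_zero_iff_eq_C.mp
      (show (borderedDet (M.map (C (σ := E))) Δ X).totalDegree = 0 by omega)
    exact ⟨_, fun α => by rw [← eval_borderedDet, h1, eval_C]⟩

theorem borderedDet_eq_zero (M : Matrix W E F) (Δ : Finset E)
    (h : Fintype.card E < Δ.card + Fintype.card W) (α : E → F) : borderedDet M Δ α = 0 := by
  by_cases h0 : borderedDet (M.map (C (σ := E))) Δ X = 0
  · rw [← eval_borderedDet, h0, map_zero]
  · have := totalDegree_borderedDet_le M Δ X (fun e => (totalDegree_X e).le) h0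
    omega

theorem borderedMinor_eq_const (M : Matrix W E F) {Δ : Finset E} {i : E} (j : E) (hi : i ∉ Δ)
    (h : Fintype.card E ≤ Δ.card + Fintype.card W + 1) :
    ∃ c, ∀ α, borderedMinor M Δ i j α = c := by
  by_cases h0 : borderedMinor (M.map (C (σ := E))) Δ i j X = 0
  · exact ⟨0, fun α => by rw [← eval_borderedMinor, h0, map_zero]⟩
  · have := totalDegree_borderedMinor_le M Δ j hi X (fun e => (totalDegree_X e).le) h0
    have h1 := totalDegree_eq_zero_iff_eq_C.mp
      (show (borderedMinor (M.map (C (σ := E))) Δ i j X).totalDegree = 0 by omega)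
    exact ⟨_, fun α => by rw [← eval_borderedMinor, h1, eval_C]⟩

theorem borderedMinor_eq_zero (M : Matrix W E F) {Δ : Finset E} {i : E} (j : E) (hi : i ∉ Δ)
    (h : Fintype.card E < Δ.card + Fintype.card W + 1) (α : E → F) :
    borderedMinor M Δ i j α = 0 := by
  by_cases h0 : borderedMinor (M.map (C (σ := E))) Δ i j X = 0
  · rw [← eval_borderedMinor, h0, map_zero]
  · have := totalDegree_borderedMinor_le M Δ j hi X (fun e => (totalDegree_X e).le) h0
    omega

variable [Fintype F] [DecidableEq F] (p : ℕ) [CharP F p]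

/-- The zeros of `C^{i,j} = f α_e + g`, counted along a third edge `e`. The number of common zeros of
`f` and `g` is written as `[f] + [g] - [f g]`. -/
theorem numZeros_borderedMinor_eq (M : Matrix W E F) {Δ s : Finset E} {i j e : E}
    (hs : e ∉ s) (he : e ∉ Δ) (hi : e ≠ i) (hj : e ≠ j) :
    numZeros s (borderedMinor M Δ i j) =
      Fintype.card F * (numZeros (insert e s) (borderedMinor M (insert e Δ) i j) +
        numZeros (insert e s) (borderedMinor M Δ i j) -
        numZeros (insert e s) (fun α => borderedMinor M (insert e Δ) i j α *
          borderedMinor M Δ i j α)) +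
      Fintype.card F ^ (Fintype.card E - (insert e s).card) -
      numZeros (insert e s) (borderedMinor M (insert e Δ) i j) := by
  have h1 : numZeros s (borderedMinor M Δ i j) = ∑ α ∈ zeroOn F (insert e s),
      ((Fintype.card F : ℤ) * (((if borderedMinor M (insert e Δ) i j α = 0 then 1 else 0) +
        (if borderedMinor M Δ i j α = 0 then 1 else 0)) -
        (if borderedMinor M (insert e Δ) i j α * borderedMinor M Δ i j α = 0 then 1 else 0)) + 1 -
        (if borderedMinor M (insert e Δ) i j α = 0 then 1 else 0)) := by
    rw [numZeros, sum_zeroOn_eq_sum_insert hs]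
    refine Finset.sum_congr rfl fun α hα => ?_
    have h0 : α e = 0 := mem_zeroOn.mp hα e (by simp)
    simp only [borderedMinor_update M α he hi hj, h0, sub_zero]
    rw [sum_affine_eq_zero]
    by_cases hf : borderedMinor M (insert e Δ) i j α = 0 <;>
      by_cases hg : borderedMinor M Δ i j α = 0 <;> simp [hf, hg]
  rw [h1]
  simp only [Finset.sum_sub_distrib, Finset.sum_add_distrib, ← Finset.mul_sum, numZeros,
    Finset.sum_const, card_zeroOn, nsmul_eq_mul, mul_one, Nat.cast_pow]

/-- The zeros of the determinant, counted along two edges `i` and `j`. -/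
theorem numZeros_borderedDet_eq (M : Matrix W E F) {Δ : Finset E} {i j : E}
    (hij : i ≠ j) (hi : i ∉ Δ) (hj : j ∉ Δ) :
    numZeros Δ (borderedDet M Δ) = (Fintype.card F : ℤ) ^ 2 *
      (∑ α ∈ zeroOn F (insert j (insert i Δ)),
        if borderedDet M Δ α = 0 ∧ borderedDet M (insert i Δ) α = 0 ∧
          borderedDet M (insert j Δ) α = 0 ∧ borderedDet M (insert j (insert i Δ)) α = 0
          then 1 else 0) +
      Fintype.card F * numZeros (insert j (insert i Δ)) (borderedMinor M Δ i j) +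
      (Fintype.card F + 1) * Fintype.card F ^ (Fintype.card E - (Δ.card + 2)) -
      numZeros (insert i Δ) (borderedDet M (insert i Δ)) -
      numZeros (insert j Δ) (borderedDet M (insert j Δ)) -
      numZeros (insert j (insert i Δ)) (borderedDet M (insert j (insert i Δ))) := by
  have hi' : i ∉ insert j Δ := by simp [hij, hi]
  have hj' : j ∉ insert i Δ := by simp [hij.symm, hj]
  have hcard : (insert j (insert i Δ)).card = Δ.card + 2 := by
    rw [Finset.card_insert_of_notMem hj', Finset.card_insert_of_notMem hi]
  have e1 : numZeros (insert i Δ) (borderedDet M (insert i Δ)) =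
      ∑ α ∈ zeroOn F (insert j (insert i Δ)), ∑ b : F,
        if borderedDet M (insert i Δ) α + b * borderedDet M (insert j (insert i Δ)) α = 0
          then 1 else 0 := by
    rw [numZeros, sum_zeroOn_eq_sum_insert hj']
    refine Finset.sum_congr rfl fun α hα => ?_
    have h0 : α j = 0 := mem_zeroOn.mp hα j (by simp)
    simp only [borderedDet_update M α hj', h0, sub_zero]
  have e2 : numZeros (insert j Δ) (borderedDet M (insert j Δ)) =
      ∑ α ∈ zeroOn F (insert j (insert i Δ)), ∑ a : F,
        if borderedDet M (insert j Δ) α + a * borderedDet M (insert j (insert i Δ)) α = 0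
          then 1 else 0 := by
    rw [numZeros, sum_zeroOn_eq_sum_insert hi', Finset.insert_comm]
    refine Finset.sum_congr rfl fun α hα => ?_
    have h0 : α i = 0 := mem_zeroOn.mp hα i (by simp)
    simp only [borderedDet_update M α hi', h0, sub_zero]
    rw [Finset.insert_comm]
  rw [e1, e2, numZeros, numZeros, sum_zeroOn_eq_sum_insert hi, sum_zeroOn_eq_sum_insert hj',
    numZeros]
  have e3 : ∀ α ∈ zeroOn F (insert j (insert i Δ)),
      (∑ b : F, ∑ a : F, if borderedDet M Δ
          (Function.update (Function.update α j b) i a) = 0 then 1 else 0 : ℤ) =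
      ∑ a : F, ∑ b : F, if borderedDet M Δ α + a * borderedDet M (insert i Δ) α +
        b * (borderedDet M (insert j Δ) α + a * borderedDet M (insert j (insert i Δ)) α) = 0
        then 1 else 0 := by
    intro α hα
    have h0 : α i = 0 := mem_zeroOn.mp hα i (by simp)
    have h0' : α j = 0 := mem_zeroOn.mp hα j (by simp)
    rw [Finset.sum_comm]
    refine Finset.sum_congr rfl fun a _ => Finset.sum_congr rfl fun b _ => ?_
    rw [borderedDet_update M _ hi, borderedDet_update M _ hj, borderedDet_update M _ hj',
      Function.update_of_ne hij, h0, h0']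
    congr 1
    apply propext
    constructor <;> intro h <;> linear_combination h
  rw [Finset.sum_congr rfl e3, Finset.sum_congr rfl fun α _ =>
    sum_sum_biaffine_eq_zero (borderedDet_mul_sub_sq M Δ α hij)]
  simp only [Finset.sum_sub_distrib, Finset.sum_add_distrib, ← Finset.mul_sum,
    Finset.sum_const, card_zeroOn, nsmul_eq_mul, hcard, Nat.cast_pow]
  ring

theorem mul_pow_dvd_card_pow {F : Type*} [Field F] [Fintype F] (p : ℕ) [CharP F p] {k n : ℕ}
    (h : k < n) : (p : ℤ) * Fintype.card F ^ k ∣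
      (Fintype.card F : ℤ) ^ n := by
  refine dvd_trans ?_ (pow_dvd_pow _ (show k + 1 ≤ n from h))
  rw [pow_succ']
  exact mul_dvd_mul_right (dvd_card_of_charP F p) _

/-- Chevalley–Warning for the product of `f = C_{Δ ∪ e}^{i,j}` and `g = C_Δ^{i,j}`. -/
theorem dvd_numZeros_borderedMinor_mul (M : Matrix W E F) {Δ s : Finset E} {i j e : E}
    (hi : i ∉ Δ) (he : e ∉ Δ) (hei : i ≠ e) (hs : s.card = Δ.card + 3)
    (hlt : Fintype.card E < Δ.card + 2 * Fintype.card W) (hE : Δ.card + 3 < Fintype.card E) :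
    (p : ℤ) ∣ numZeros s (fun α => borderedMinor M (insert e Δ) i j α *
      borderedMinor M Δ i j α) := by
  rw [show (fun α => borderedMinor M (insert e Δ) i j α * borderedMinor M Δ i j α) =
    fun α => eval α (borderedMinor (M.map C) (insert e Δ) i j X *
      borderedMinor (M.map C) Δ i j X) by
    ext α; rw [map_mul, eval_borderedMinor, eval_borderedMinor]]
  apply dvd_numZeros_of_totalDegree_lt
  by_cases hf : borderedMinor (M.map (C (σ := E))) (insert e Δ) i j X = 0
  · rw [hf, zero_mul, totalDegree_zero]; omega
  by_cases hg : borderedMinor (M.map (C (σ := E))) Δ i j X = 0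
  · rw [hg, mul_zero, totalDegree_zero]; omega
  have h1 := totalDegree_borderedMinor_le M (insert e Δ) j (by simp [hi, hei]) X
    (fun e => (totalDegree_X e).le) hf
  have h2 := totalDegree_borderedMinor_le M Δ j hi X (fun e => (totalDegree_X e).le) hg
  rw [Finset.card_insert_of_notMem he] at h1
  refine (totalDegree_mul _ _).trans_lt ?_
  omega

theorem dvd_numZeros_borderedMinor_of_lt (M : Matrix W E F) {Δ s : Finset E} {i j : E}
    (hi : i ∉ Δ) (hs : s.card < Δ.card + Fintype.card W + 1) (hE : s.card < Fintype.card E) :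
    (p : ℤ) ∣ numZeros s (borderedMinor M Δ i j) := by
  rw [show borderedMinor M Δ i j = fun α => eval α (borderedMinor (M.map C) Δ i j X) by
    ext α; rw [eval_borderedMinor]]
  apply dvd_numZeros_of_totalDegree_lt
  by_cases hg : borderedMinor (M.map (C (σ := E))) Δ i j X = 0
  · rw [hg, totalDegree_zero]; omega
  have h2 := totalDegree_borderedMinor_le M Δ j hi X (fun e => (totalDegree_X e).le) hg
  omega

/-- If the number of remaining edges is less than twice the number of rows of `M`, then the number of
zeros of the minor is divisible by `p q`. Here `n` is the number of variables of the minor. -/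
theorem dvd_numZeros_borderedMinor (hW : 3 ≤ Fintype.card W) (M : Matrix W E F) (n : ℕ)
    {Δ : Finset E} {i j : E} (hij : i ≠ j) (hi : i ∉ Δ) (hj : j ∉ Δ)
    (hn : Δ.card + 2 + n = Fintype.card E) (hle : Δ.card + Fintype.card W + 1 ≤ Fintype.card E)
    (hlt : Fintype.card E < Δ.card + 2 * Fintype.card W) :
    (p : ℤ) * Fintype.card F ∣ numZeros (insert j (insert i Δ)) (borderedMinor M Δ i j) := by
  induction n generalizing Δ with
  | zero => omega
  | succ n ih =>
    have hcard : (insert j (insert i Δ)).card = Δ.card + 2 := by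
      rw [Finset.card_insert_of_notMem (by simp [hij.symm, hj]), Finset.card_insert_of_notMem hi]
    -- If the minor has degree zero, it is constant and `q ^ 2` divides the number of points.
    by_cases h1 : Fintype.card E = Δ.card + Fintype.card W + 1
    · obtain ⟨c, hc⟩ := borderedMinor_eq_const M j hi h1.le
      rw [show borderedMinor M Δ i j = fun _ => c from funext hc]
      refine numZeros_const _ _ _ ?_
      have := mul_pow_dvd_card_pow (F := F) p (k := 1)
        (n := Fintype.card E - (insert j (insert i Δ)).card) (by omega)
      rwa [pow_one] at this
    · obtain ⟨e, he⟩ : ∃ e, e ∉ insert j (insert i Δ) := by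
        by_contra! hall
        have := Finset.card_le_card (fun x _ => hall x : Finset.univ ⊆ insert j (insert i Δ))
        rw [Finset.card_univ] at this
        omega
      have hes := he
      simp only [Finset.mem_insert, not_or] at he
      obtain ⟨hej, hei, heΔ⟩ := he
      have hcard' : (insert e (insert j (insert i Δ))).card = Δ.card + 3 := by
        rw [Finset.card_insert_of_notMem hes, hcard]
      rw [numZeros_borderedMinor_eq M hes heΔ hei hej]
      have hf : (p : ℤ) * Fintype.card F ∣
          numZeros (insert e (insert j (insert i Δ))) (borderedMinor M (insert e Δ) i j) := by
        have hc := Finset.card_insert_of_notMem heΔ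
        have := ih (Δ := insert e Δ) (by simp [hi, Ne.symm hei]) (by simp [hj, Ne.symm hej])
          (by omega) (by omega) (by omega)
        rwa [Finset.insert_comm i, Finset.insert_comm j] at this
      have hg := dvd_numZeros_borderedMinor_of_lt p M (Δ := Δ)
        (s := insert e (insert j (insert i Δ))) (j := j) hi (by omega) (by omega)
      have hfg := dvd_numZeros_borderedMinor_mul p M (Δ := Δ)
        (s := insert e (insert j (insert i Δ))) (j := j) hi heΔ (Ne.symm hei) hcard' hlt (by omega)
      refine dvd_sub (dvd_add ?_ ?_) hf
      · rw [mul_comm]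
        exact mul_dvd_mul_left _ (dvd_sub (dvd_add (dvd_trans (dvd_mul_right _ _) hf) hg) hfg)
      · have := mul_pow_dvd_card_pow (F := F) p (k := 1)
          (n := Fintype.card E - (insert e (insert j (insert i Δ))).card) (by omega)
        rwa [pow_one] at this

/-- `[D] ≡ q [C^{i,j}]` modulo `p q²`, provided that the determinants with more deleted edges have a
number of zeros divisible by `p q²`. -/
theorem dvd_numZeros_borderedDet_sub_borderedMinor (hW : 3 ≤ Fintype.card W) (M : Matrix W E F)
    {Δ : Finset E} {i j : E} (hij : i ≠ j) (hi : i ∉ Δ) (hj : j ∉ Δ)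
    (hle : Δ.card + Fintype.card W + 1 ≤ Fintype.card E)
    (h : ∀ Δ' : Finset E, Δ.card < Δ'.card → Δ'.card + Fintype.card W ≤ Fintype.card E →
      (p : ℤ) * Fintype.card F ^ 2 ∣ numZeros Δ' (borderedDet M Δ')) :
    (p : ℤ) * Fintype.card F ^ 2 ∣ numZeros Δ (borderedDet M Δ) -
      Fintype.card F * numZeros (insert j (insert i Δ)) (borderedMinor M Δ i j) := by
  have hci := Finset.card_insert_of_notMem hi
  have hcj := Finset.card_insert_of_notMem hj
  have hcard : (insert j (insert i Δ)).card = Δ.card + 2 := by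
    rw [Finset.card_insert_of_notMem (by simp [hij.symm, hj]), hci]
  have h4 := dvd_sum_zeroOn_four p M hij hi hj hW (by omega)
  have h1 := h (insert i Δ) (by omega) (by omega)
  have h2 := h (insert j Δ) (by omega) (by omega)
  have h3 : (p : ℤ) * Fintype.card F ^ 2 ∣
      (Fintype.card F + 1) * (Fintype.card F : ℤ) ^ (Fintype.card E - (Δ.card + 2)) -
        numZeros (insert j (insert i Δ)) (borderedDet M (insert j (insert i Δ))) := by
    -- If `D` is linear, then `D_{ij} = 0` cancels the term `q ^ (N - 2)`, which for `N = 4` is not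
    -- divisible by `p q ^ 2`.
    by_cases hE : Fintype.card E = Δ.card + Fintype.card W + 1
    · rw [show borderedDet M (insert j (insert i Δ)) = fun _ => 0 from
        funext (borderedDet_eq_zero M _ (by omega)), numZeros_zero, hcard]
      have := mul_pow_dvd_card_pow (F := F) p (k := 2)
        (n := Fintype.card E - (Δ.card + 2) + 1) (by omega)
      rw [pow_succ _ (Fintype.card E - (Δ.card + 2))] at this
      convert this using 1
      ring
    · exact dvd_sub (dvd_mul_of_dvd_right (mul_pow_dvd_card_pow p (by omega)) _)
        (h _ (by omega) (by omega))
  rw [numZeros_borderedDet_eq M hij hi hj]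
  obtain ⟨a, h4⟩ := h4
  obtain ⟨b, h3⟩ := h3
  obtain ⟨c, h1⟩ := h1
  obtain ⟨d, h2⟩ := h2
  refine ⟨a + b - c - d, ?_⟩
  linear_combination (Fintype.card F : ℤ) ^ 2 * h4 + h3 - h1 - h2

/-- If the number `n` of remaining edges is less than twice the number of rows of `M`, then the number
of zeros of the determinant is divisible by `p q²`. -/
theorem dvd_numZeros_borderedDet (hW : 3 ≤ Fintype.card W) (M : Matrix W E F) (n : ℕ)
    {Δ : Finset E} (hn : Δ.card + n = Fintype.card E)
    (hle : Δ.card + Fintype.card W ≤ Fintype.card E)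
    (hlt : Fintype.card E < Δ.card + 2 * Fintype.card W) :
    (p : ℤ) * Fintype.card F ^ 2 ∣ numZeros Δ (borderedDet M Δ) := by
  induction n using Nat.strong_induction_on generalizing Δ with
  | _ n ih =>
    -- In degree zero the determinant is constant, and `q ^ 3` divides the number of points.
    by_cases h0 : Fintype.card E = Δ.card + Fintype.card W
    · obtain ⟨c, hc⟩ := borderedDet_eq_const M Δ h0.le
      rw [show borderedDet M Δ = fun _ => c from funext hc]
      exact numZeros_const _ _ _ (mul_pow_dvd_card_pow p (by omega))
    · obtain ⟨i, hi, j, hj, hij⟩ : ∃ i ∈ Δᶜ, ∃ j ∈ Δᶜ, i ≠ j := by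
        rw [← Finset.one_lt_card, Finset.card_compl]
        omega
      rw [Finset.mem_compl] at hi hj
      have h1 := dvd_numZeros_borderedDet_sub_borderedMinor p hW M hij hi hj (by omega)
        fun Δ' hΔ hΔ' => ih (Fintype.card E - Δ'.card) (by omega) (by omega) hΔ' (by omega)
      have h2 := dvd_numZeros_borderedMinor p hW M (Fintype.card E - (Δ.card + 2)) hij hi hj
        (by omega) (by omega) hlt
      obtain ⟨a, h1⟩ := h1
      obtain ⟨b, h2⟩ := h2
      exact ⟨a + b, by linear_combination h1 + (Fintype.card F : ℤ) * h2⟩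

theorem sum_quadraticChar_sq (s : Finset E) (φ : (E → F) → F) :
    ∑ α ∈ zeroOn F s, quadraticChar F (φ α ^ 2) =
      (Fintype.card F : ℤ) ^ (Fintype.card E - s.card) - numZeros s φ := by
  have : ∀ α, quadraticChar F (φ α ^ 2) = 1 - if φ α = 0 then 1 else 0 := by
    intro α
    split_ifs with h
    · simp [h]
    · rw [quadraticChar_sq_one' h, sub_zero]
  simp only [this, Finset.sum_sub_distrib, numZeros, Finset.sum_const, card_zeroOn,
    nsmul_eq_mul, mul_one, Nat.cast_pow]

/-- The case of three edges for an arbitrary matrix: modulo `p q²`, the number of zeros of the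
determinant is `q²` times the Legendre sum of the three-edge invariant. -/
theorem dvd_numZeros_borderedDet_sub (hW : 3 ≤ Fintype.card W)
    (hE : 3 ≤ Fintype.card E) (hEW : Fintype.card E ≤ 2 * Fintype.card W) (M : Matrix W E F)
    {i j e : E} (hij : i ≠ j) (hei : e ≠ i) (hej : e ≠ j) :
    (p : ℤ) * Fintype.card F ^ 2 ∣ numZeros ∅ (borderedDet M ∅) - Fintype.card F ^ 2 *
      ∑ α ∈ zeroOn F {e, j, i},
        quadraticChar F ((borderedMinor M {e} i j α * borderedMinor M ∅ i j α) ^ 2) := by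
  have hi : i ∉ ({e} : Finset E) := by simpa using hei.symm
  have hj : j ∉ ({e} : Finset E) := by simpa using hej.symm
  by_cases h0 : Fintype.card E ≤ Fintype.card W
  · obtain ⟨c, hc⟩ := borderedDet_eq_const M ∅ (by simpa using h0)
    have hf := borderedMinor_eq_zero M j hi (by simp; omega)
    simp only [hf, zero_mul, zero_pow two_ne_zero, quadraticChar_zero, Finset.sum_const_zero,
      mul_zero, sub_zero]
    rw [show borderedDet M ∅ = fun _ => c from funext hc]
    exact numZeros_const _ _ _ (mul_pow_dvd_card_pow p (by simp; omega))
  · have hs : e ∉ insert j (insert i (∅ : Finset E)) := by simp [hei, hej]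
    have hcard : (insert e (insert j (insert i (∅ : Finset E)))).card = 3 := by
      simp [hei, hej, hij.symm]
    have hD := dvd_numZeros_borderedDet_sub_borderedMinor p hW M (Δ := ∅) hij (by simp) (by simp)
      (by simp; omega) fun Δ' hΔ hΔ' => dvd_numZeros_borderedDet p hW M
        (Fintype.card E - Δ'.card) (by omega) hΔ' (by rw [Finset.card_empty] at hΔ; omega)
    have hC := numZeros_borderedMinor_eq M (Δ := ∅) hs (by simp) hei hej
    have hg := dvd_numZeros_borderedMinor_of_lt p M (Δ := ∅)
      (s := insert e (insert j (insert i ∅))) (i := i) (j := j) (by simp)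
      (by rw [hcard]; omega) (by omega)
    have hf : (p : ℤ) * Fintype.card F ∣ Fintype.card F *
        numZeros (insert e (insert j (insert i ∅))) (borderedMinor M (insert e ∅) i j) +
        (Fintype.card F : ℤ) ^ (Fintype.card E - 3) -
        numZeros (insert e (insert j (insert i ∅))) (borderedMinor M (insert e ∅) i j) := by
      -- For `|E| = |W| + 1` the polynomial `f` is zero, and two of the three terms cancel.
      by_cases h1 : Fintype.card E = Fintype.card W + 1
      · rw [show borderedMinor M (insert e ∅) i j = fun _ => 0 from
          funext (borderedMinor_eq_zero M j hi (by simp; omega)), numZeros_zero, hcard]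
        have := mul_pow_dvd_card_pow (F := F) p (k := 1)
          (n := Fintype.card E - 3 + 1) (by omega)
        rw [pow_succ _ (Fintype.card E - 3), pow_one] at this
        convert this using 1
        ring
      · have h2 := dvd_numZeros_borderedMinor p hW M (Δ := {e}) (Fintype.card E - 3) hij hi hj
          (by simp; omega) (by simp; omega) (by simp; omega)
        rw [← insert_empty_eq, Finset.insert_comm i, Finset.insert_comm j] at h2
        have := mul_pow_dvd_card_pow (F := F) p (k := 1)
          (n := Fintype.card E - 3) (by omega)
        rw [pow_one] at this
        exact dvd_sub (dvd_add (dvd_mul_of_dvd_right h2 _) this) h2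
    have hq : (p : ℤ) * Fintype.card F ∣ Fintype.card F *
        (numZeros (insert e (insert j (insert i ∅))) (borderedMinor M ∅ i j) -
          (Fintype.card F : ℤ) ^ (Fintype.card E - 3)) := by
      rw [mul_comm]
      refine mul_dvd_mul_left _ (dvd_sub hg ?_)
      have := mul_pow_dvd_card_pow (F := F) p (k := 0) (n := Fintype.card E - 3) (by omega)
      simpa using this
    have hsum := sum_quadraticChar_sq {e, j, i}
      fun α => borderedMinor M {e} i j α * borderedMinor M ∅ i j α
    rw [show ({e, j, i} : Finset E).card = 3 from hcard] at hsum
    rw [hsum]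
    rw [hC, hcard] at hD
    simp only [insert_empty_eq] at hD hf hq
    obtain ⟨a, hD⟩ := hD
    obtain ⟨b, hf⟩ := hf
    obtain ⟨c, hq⟩ := hq
    refine ⟨a + b + c, ?_⟩
    linear_combination hD + (Fintype.card F : ℤ) * hf + (Fintype.card F : ℤ) * hq

end CountModP

/-! ### The matrix-tree theorem and Dodgson polynomials -/

section Expansion

variable {E W R : Type*} [Fintype E] [DecidableEq E] [Fintype W] [DecidableEq W] [CommRing R]

/-- If the weights `u`, `v` have negative sum, but nonnegative sum `u a + v b` at every nonzero entry
`(a, b)`, then every term of the Leibniz formula vanishes. -/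
theorem Matrix.det_eq_zero_of_weights {ι : Type*} [Fintype ι] [DecidableEq ι] (A : Matrix ι ι R)
    (u v : ι → ℤ) (h : ∀ a b, A a b ≠ 0 → 0 ≤ u a + v b) (hlt : ∑ a, u a + ∑ a, v a < 0) :
    A.det = 0 := by
  rw [det_apply]
  refine Finset.sum_eq_zero fun σ _ => ?_
  have hsum : ∑ i, (u (σ i) + v i) < 0 := by
    rwa [Finset.sum_add_distrib, Equiv.sum_comp σ u]
  obtain ⟨i, -, hi⟩ : ∃ i ∈ Finset.univ, u (σ i) + v i < 0 := by
    by_contra! hc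
    exact absurd (Finset.sum_nonneg hc) (not_le.mpr hsum)
  rw [Finset.prod_eq_zero (Finset.mem_univ i), smul_zero]
  by_contra h0
  exact absurd (h _ _ h0) (not_le.mpr hi)

/-- Expansion of the determinant in the variables of `U`. -/
theorem borderedDet_eq_sum_powerset (M : Matrix W E R) (α : E → R) (U : Finset E) :
    borderedDet M ∅ α = ∑ S ∈ U.powerset, (∏ e ∈ S, α e) *
      borderedDet M S (fun e => if e ∈ U then 0 else α e) := by
  induction U using Finset.induction_on with
  | empty => simp
  | insert e U he ih =>
    rw [Finset.sum_powerset_insert he, ih, ← Finset.sum_add_distrib]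
    refine Finset.sum_congr rfl fun S hS => ?_
    have heS : e ∉ S := fun h => he (Finset.mem_powerset.mp hS h)
    set β : E → R := fun x => if x ∈ insert e U then 0 else α x with hβ
    have h1 : (fun x => if x ∈ U then 0 else α x) = Function.update β e (α e) := by
      ext x
      by_cases hx : x = e
      · subst hx; simp [he]
      · simp [hx, hβ]
    have h0 : β e = 0 := by simp [hβ]
    rw [h1, borderedDet_update M β heS, h0, Finset.prod_insert heS]
    ring

/-- At `α = 0` the determinant vanishes unless the restriction of `M` to the remaining edges is a
square matrix. -/
theorem borderedDet_zero_eq_zero (M : Matrix W E R) (S : Finset E)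
    (h : S.card + Fintype.card W ≠ Fintype.card E) : borderedDet M S 0 = 0 := by
  have hsum := sum_ite_mem_zero_one S
  rcases lt_or_gt_of_ne h with h | h
  · refine det_eq_zero_of_weights _ (Sum.elim (fun e => if e ∈ S then 0 else - 1) fun _ => 0)
      (Sum.elim 0 1) ?_ ?_
    · rintro (x | x) (y | y) hxy
      · by_cases hx : x ∈ S
        · simp [hx]
        · exfalso
          apply hxy
          by_cases hxy : x = y
          · subst hxy; simp [bordered, hx]
          · simp [bordered, hxy]
      · by_cases hx : x ∈ S <;> simp [hx]
      · simp
      · simp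
    · have : ∑ e : E, (if e ∈ S then (0 : ℤ) else -1) = - (Fintype.card E - S.card) := by
        rw [← hsum, ← Finset.sum_neg_distrib]
        refine Finset.sum_congr rfl fun e _ => ?_
        split_ifs <;> simp
      simp only [Fintype.sum_sum_type, Sum.elim_inl, Sum.elim_inr, this]
      simp
      omega
  · refine det_eq_zero_of_weights _ (Sum.elim (fun e => if e ∈ S then 0 else 1) fun _ => 0)
      (Sum.elim 0 (-1)) ?_ ?_
    · rintro (x | x) (y | y) hxy
      · by_cases hx : x ∈ S <;> simp [hx]
      · by_cases hx : x ∈ S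
        · simp [bordered, hx] at hxy
        · simp [hx]
      · simp
      · simp [bordered] at hxy
    · simp only [Fintype.sum_sum_type, Sum.elim_inl, Sum.elim_inr, hsum]
      simp
      omega

/-- At `α = 0` the determinant is, up to sign, the square of the maximal minor of `M` on the remaining
edges, which are enumerated by `f`. The sign is that of the case where this minor is the identity. -/
theorem borderedDet_zero_eq_det_sq (M : Matrix W E R) (S : Finset E) (f : W → E)
    (hf : Function.Injective f) (hS : ∀ e, e ∉ S ↔ ∃ w, f w = e) :
    borderedDet M S 0 = (-1) ^ Fintype.card W * (M.submatrix id f).det ^ 2 := by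
  set J : Matrix W E R := of fun w e => if f w = e then 1 else 0 with hJ
  set B := M.submatrix id f with hB
  have hBJ : B * J = of fun w e => if e ∈ S then 0 else M w e := by
    ext w e
    by_cases he : e ∈ S
    · have : ∀ w, f w ≠ e := fun w h => (hS e).mpr ⟨w, h⟩ he
      simp [mul_apply, hJ, this, he]
    · obtain ⟨w', rfl⟩ := (hS e).mp he
      simp [mul_apply, hJ, he, hf.eq_iff, hB]
  have hJJ : Jᵀ * J = diagonal fun e => if e ∈ S then 0 else 1 := by
    ext e e'
    rw [mul_apply]
    by_cases he : e ∈ S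
    · have : ∀ w, f w ≠ e := fun w h => (hS e).mpr ⟨w, h⟩ he
      simp [hJ, this, diagonal_apply, he]
    · obtain ⟨w', rfl⟩ := (hS e).mp he
      rw [Finset.sum_eq_single w']
      · simp [hJ, diagonal_apply, he]
      · intro w _ hw
        simp [hJ, hf.eq_iff, hw]
      · simp
  have hJJ' : J * Jᵀ = 1 := by
    ext w w'
    simp [mul_apply, hJ, one_apply, hf.eq_iff, eq_comm]
  set I : Matrix E E R := diagonal fun e => if e ∈ S then 1 else 0 with hI
  have h1 : bordered M S 0 = fromBlocks 1 0 0 B * fromBlocks I Jᵀ J 0 * fromBlocks 1 0 0 Bᵀ := by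
    rw [fromBlocks_multiply, fromBlocks_multiply]
    simp only [Matrix.one_mul, Matrix.zero_mul, Matrix.mul_zero, Matrix.mul_one, add_zero,
      zero_add, hBJ, ← transpose_mul]
    rfl
  have h2 : fromBlocks 1 Jᵀ 0 1 * fromBlocks I Jᵀ J 0 = fromBlocks 1 Jᵀ J 0 := by
    rw [fromBlocks_multiply]
    simp only [Matrix.one_mul, Matrix.zero_mul, Matrix.mul_zero, add_zero, zero_add, hJJ, hI,
      diagonal_add]
    congr 1
    rw [← diagonal_one]
    congr 1
    ext e
    split_ifs <;> simp
  have h3 : (fromBlocks I Jᵀ J (0 : Matrix W W R)).det = (-1) ^ Fintype.card W := by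
    have := congrArg det h2
    rw [det_mul, det_fromBlocks_zero₂₁, det_one, det_one, one_mul, one_mul, det_fromBlocks_one₁₁,
      hJJ', zero_sub, det_neg, det_one, mul_one] at this
    exact this
  rw [borderedDet, h1, det_mul, det_mul, h3, det_fromBlocks_zero₂₁, det_fromBlocks_zero₂₁,
    det_one, det_transpose]
  ring

end Expansion

section RemoveVertex

/-- Removing the row and the column of the vertex `v`. -/
theorem det_updateRow_inr {E V R : Type*} [Fintype E] [DecidableEq E] [Fintype V] [DecidableEq V]
    [CommRing R] (A : Matrix (E ⊕ V) (E ⊕ V) R) (v : V) :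
    (A.updateRow (Sum.inr v) (Pi.single (Sum.inr v) 1)).det =
      (A.submatrix (Sum.map id Subtype.val) (Sum.map id (Subtype.val : {w // w ≠ v} → V))).det := by
  rw [twoBlockTriangular_det _ (fun x => x ≠ Sum.inr v)]
  · let φ : E ⊕ {w // w ≠ v} ≃ {x : E ⊕ V // x ≠ Sum.inr v} :=
      { toFun := Sum.elim (fun e => ⟨Sum.inl e, by simp⟩) fun w => ⟨Sum.inr w, by simpa using w.2⟩
        invFun := fun x => match x with
          | ⟨Sum.inl e, _⟩ => Sum.inl e
          | ⟨Sum.inr w, h⟩ => Sum.inr ⟨w, by simpa using h⟩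
        left_inv := by rintro (e | w) <;> rfl
        right_inv := by rintro ⟨e | w, h⟩ <;> rfl }
    have hφ : ∀ x, (φ x : E ⊕ V) = Sum.map id Subtype.val x := by rintro (e | w) <;> rfl
    have h2 : (toSquareBlockProp (A.updateRow (Sum.inr v) (Pi.single (Sum.inr v) 1))
        fun x => ¬ x ≠ Sum.inr v) = 1 := by
      ext ⟨x, hx⟩ ⟨y, hy⟩
      rw [not_not] at hx hy
      subst hx; subst hy
      simp [toSquareBlockProp_def]
    rw [h2, det_one, mul_one, ← det_submatrix_equiv_self φ]
    congr 1
    ext x y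
    simp only [toSquareBlockProp_def, submatrix_apply, of_apply]
    rw [updateRow_ne (φ x).2, hφ, hφ]
  · intro x hx y hy
    rw [not_not] at hx
    subst hx
    simp [hy]

theorem submatrix_updateRow_inl {E V R : Type*} [DecidableEq E] [DecidableEq V]
    (A : Matrix (E ⊕ V) (E ⊕ V) R) (i : E) (r : E ⊕ V → R) (v : V) :
    (A.updateRow (Sum.inl i) r).submatrix (Sum.map id Subtype.val)
      (Sum.map id (Subtype.val : {w // w ≠ v} → V)) =
    (A.submatrix (Sum.map id (Subtype.val : {w // w ≠ v} → V)) (Sum.map id Subtype.val)).updateRow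
      (Sum.inl i)      (r ∘ Sum.map id Subtype.val) := by
  ext (x | x) y
  · by_cases hx : x = i
    · subst hx; simp
    · simp [hx]
  · simp

theorem single_comp_sumMap {E V R : Type*} [DecidableEq E] [DecidableEq V] [Zero R] [One R]
    (j : E) (v : V) :
    (Pi.single (Sum.inl j) 1 : E ⊕ V → R) ∘ Sum.map id (Subtype.val : {w // w ≠ v} → V) =
      Pi.single (Sum.inl j) 1 := by
  ext (x | x)
  · by_cases hx : x = j
    · subst hx; simp
    · simp [hx]
  · simp

end RemoveVertex

namespace Multigraph

variable {V E : Type*} [DecidableEq V] (G : Multigraph V E)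

/-- The signed incidence matrix without the row of the vertex `v`. -/
def reducedIncidence (v : V) (R : Type*) [CommRing R] : Matrix {w // w ≠ v} E R :=
  (G.incidence R).submatrix Subtype.val id

theorem map_reducedIncidence (v : V) {R S : Type*} [CommRing R] [CommRing S] (f : R →+* S) :
    (G.reducedIncidence v R).map f = G.reducedIncidence v S := by
  ext w e
  simp only [reducedIncidence, incidence, map_apply, submatrix_apply, of_apply, id_eq, map_sub]
  split_ifs <;> simp

theorem laplacian_submatrix [DecidableEq E] (K : Finset E) (v : V) :
    (G.laplacian K).submatrix (Sum.map id Subtype.val)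
      (Sum.map id (Subtype.val : {w // w ≠ v} → V)) =
    bordered (G.reducedIncidence v (MvPolynomial E ℤ)) ∅ fun e => if e ∈ K then 0 else X e := by
  ext (x | x) (y | y) : 2 <;> simp [laplacian, bordered, reducedIncidence]

variable [Fintype V]

/-- If `T` does not connect the vertices, the indicator of the vertices not reachable from `v` is in
the left kernel. -/
theorem det_reducedIncidence_eq_zero {T : Finset E} (v : V) (f : {w // w ≠ v} → E)
    (hf : ∀ w, f w ∈ T) (hT : ¬ G.ConnectedBy T) :
    ((G.reducedIncidence v ℤ).submatrix id f).det = 0 := by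
  classical
  set H := SimpleGraph.fromRel fun u v : V => ∃ e ∈ T, G.src e = u ∧ G.tgt e = v with hH
  obtain ⟨u, hu⟩ : ∃ u, ¬ H.Reachable v u := by
    by_contra! hc
    have : Nonempty V := ⟨v⟩
    exact hT (SimpleGraph.Connected.mk fun a b => (hc a).symm.trans (hc b))
  have huv : u ≠ v := by rintro rfl; exact hu (SimpleGraph.Reachable.refl u)
  refine exists_vecMul_eq_zero_iff.mp ⟨fun w => if H.Reachable v w then 0 else 1, ?_, ?_⟩
  · intro h
    have := congrFun h ⟨u, huv⟩
    simp [hu] at this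
  · set ψ : V → ℤ := fun w => if H.Reachable v w then 0 else 1 with hψ
    have hψv : ψ v = 0 := by simp [hψ]
    have hsum : ∀ x : V, ∑ w : {w // w ≠ v}, ψ w * (if x = w then 1 else 0) = ψ x := by
      intro x
      by_cases hx : x = v
      · rw [hx, hψv]
        exact Finset.sum_eq_zero fun w _ => by rw [if_neg w.2.symm, mul_zero]
      · rw [Finset.sum_eq_single ⟨x, hx⟩]
        · simp
        · intro b _ hb
          rw [if_neg, mul_zero]
          intro h
          exact hb (Subtype.ext h.symm)
        · simp
    ext w
    have hreach : H.Reachable (G.src (f w)) (G.tgt (f w)) := by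
      by_cases h : G.src (f w) = G.tgt (f w)
      · rw [h]
      · exact SimpleGraph.Adj.reachable ⟨h, Or.inl ⟨f w, hf w, rfl, rfl⟩⟩
    have : ψ (G.src (f w)) = ψ (G.tgt (f w)) := by
      simp only [hψ]
      have : H.Reachable v (G.src (f w)) ↔ H.Reachable v (G.tgt (f w)) :=
        ⟨fun h => h.trans hreach, fun h => h.trans hreach.symm⟩
      simp only [this]
    simp only [vecMul, dotProduct, reducedIncidence, incidence, submatrix_apply, of_apply, id_eq,
      mul_sub, Finset.sum_sub_distrib, Pi.zero_apply]
    rw [sub_eq_zero]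
    exact (hsum _).trans (this.trans (hsum _).symm)

/-- If `T` connects the vertices, the columns in `T` generate `ℤ^W`: going along a path from `v`, one
obtains every unit vector. Hence the minor is a unit of `ℤ`. -/
theorem det_reducedIncidence_sq_eq_one {T : Finset E} (v : V) (f : {w // w ≠ v} → E)
    (hf : ∀ e ∈ T, ∃ w, f w = e) (hT : G.ConnectedBy T) :
    ((G.reducedIncidence v ℤ).submatrix id f).det ^ 2 = 1 := by
  set B := (G.reducedIncidence v ℤ).submatrix id f with hB
  let δ : V → {w // w ≠ v} → ℤ := fun u w => if u = w then 1 else 0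
  have hcol : ∀ e ∈ T, δ (G.src e) - δ (G.tgt e) ∈ LinearMap.range B.mulVecLin := by
    intro e he
    obtain ⟨w, rfl⟩ := hf e he
    refine ⟨Pi.single w 1, ?_⟩
    ext x
    simp [hB, reducedIncidence, incidence, δ]
  have hδ : ∀ u, δ u ∈ LinearMap.range B.mulVecLin := by
    intro u
    have hr := (SimpleGraph.reachable_iff_reflTransGen v u).mp (hT.preconnected v u)
    induction hr with
    | refl =>
      have : δ v = 0 := by
        ext w
        simp [δ, w.2.symm]
      rw [this]
      exact Submodule.zero_mem _
    | tail _ hadj ih =>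
      obtain ⟨-, ⟨e, he, h1, h2⟩ | ⟨e, he, h1, h2⟩⟩ := hadj
      · have := Submodule.sub_mem _ ih (hcol e he)
        rwa [h1, h2, sub_sub_cancel] at this
      · have := Submodule.add_mem _ ih (hcol e he)
        rwa [h1, h2, add_sub_cancel] at this
  choose N hN using fun w : {w // w ≠ v} => hδ w
  have hBN : B * (of N)ᵀ = 1 := by
    ext x y
    have := congrFun (hN y) x
    simp only [mulVecLin_apply, mulVec, dotProduct, δ] at this
    simp only [mul_apply, transpose_apply, of_apply, this, one_apply, Subtype.ext_iff, eq_comm]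
  have hdet := congrArg det hBN
  rw [det_mul, det_one] at hdet
  rcases Int.isUnit_iff.mp (IsUnit.of_mul_eq_one _ hdet) with h | h <;> rw [h] <;> norm_num

/-- `h₁ ≥ |E| - |V| + 1`, because the rows of the incidence matrix add up to zero. -/
theorem card_le_of_two_mul_h1_le [Fintype E] (hV : 0 < Fintype.card V)
    (h : 2 * G.h1 ≤ Fintype.card E) : Fintype.card E ≤ 2 * (Fintype.card V - 1) := by
  have hrank := (G.incidence ℚ).mulVecLin.finrank_range_add_finrank_ker
  rw [Module.finrank_fintype_fun_eq_card] at hrank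
  have hlt : Module.finrank ℚ (LinearMap.range (G.incidence ℚ).mulVecLin) < Fintype.card V := by
    rw [← Module.finrank_fintype_fun_eq_card ℚ (η := V)]
    refine Submodule.finrank_lt fun htop => ?_
    obtain ⟨v⟩ := Fintype.card_pos_iff.mp hV
    obtain ⟨x, hx⟩ : Pi.single v 1 ∈ LinearMap.range (G.incidence ℚ).mulVecLin := by
      rw [htop]; trivial
    have h1 : (1 : V → ℚ) ⬝ᵥ (G.incidence ℚ *ᵥ x) = 0 := by
      rw [dotProduct_mulVec]
      have : (1 : V → ℚ) ᵥ* G.incidence ℚ = 0 := by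
        ext e
        simp [vecMul, dotProduct, incidence]
      rw [this, zero_dotProduct]
    rw [mulVecLin_apply] at hx
    rw [hx] at h1
    simp at h1
  rw [h1] at h
  omega

variable [Fintype E] [DecidableEq E]

theorem borderedDet_reducedIncidence_zero (v : V) (S : Finset E) :
    borderedDet (G.reducedIncidence v ℤ) S 0 = open Classical in
      if G.IsSpanningTree Sᶜ then (-1) ^ (Fintype.card V - 1) else 0 := by
  have hW : Fintype.card {w // w ≠ v} = Fintype.card V - 1 := by simp
  have hV : 0 < Fintype.card V := Fintype.card_pos_iff.mpr ⟨v⟩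
  have hc := Finset.card_compl_add_card S
  by_cases hcard : S.card + Fintype.card {w // w ≠ v} = Fintype.card E
  · have hcard' : Fintype.card {w // w ≠ v} = Fintype.card {e // e ∈ Sᶜ} := by
      rw [Fintype.card_coe]
      omega
    let φ := Fintype.equivOfCardEq hcard'
    have hsurj : ∀ e ∈ Sᶜ, ∃ w, (φ w : E) = e := fun e he => ⟨φ.symm ⟨e, he⟩, by simp⟩
    rw [borderedDet_zero_eq_det_sq _ S (fun w => (φ w : E))
      (Subtype.val_injective.comp φ.injective) fun e =>
        ⟨fun he => hsurj e (by simpa using he), by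
          rintro ⟨w, rfl⟩; exact Finset.mem_compl.mp (φ w).2⟩, hW]
    by_cases hT : G.ConnectedBy Sᶜ
    · rw [if_pos ⟨hT, by omega⟩, G.det_reducedIncidence_sq_eq_one v _ hsurj hT, mul_one]
    · rw [if_neg fun h => hT h.1, G.det_reducedIncidence_eq_zero v _ (fun w => (φ w).2) hT]
      simp
  · rw [borderedDet_zero_eq_zero _ _ hcard, if_neg]
    rintro ⟨-, h⟩
    omega

/-- The **matrix-tree theorem** for the graph polynomial. -/
theorem graphPolynomial_eq (v : V) : G.graphPolynomial =
    (-1) ^ (Fintype.card V - 1) * borderedDet (G.reducedIncidence v (MvPolynomial E ℤ)) ∅ X := by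
  classical
  have h0 : ∀ S : Finset E, borderedDet (G.reducedIncidence v (MvPolynomial E ℤ)) S 0 =
      C (borderedDet (G.reducedIncidence v ℤ) S 0) := by
    intro S
    rw [map_borderedDet, G.map_reducedIncidence]
    congr 1
    ext; simp
  rw [borderedDet_eq_sum_powerset _ _ Finset.univ, Finset.powerset_univ, graphPolynomial,
    Finset.sum_filter, Finset.mul_sum]
  refine (Equiv.sum_comp (compl_involutive (α := Finset E)).toPerm _).symm.trans ?_
  refine Finset.sum_congr rfl fun S _ => ?_
  rw [show (fun e => if e ∈ Finset.univ then 0 else (X e : MvPolynomial E ℤ)) = 0 by ext; simp, h0,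
    G.borderedDet_reducedIncidence_zero, Function.Involutive.coe_toPerm]
  split_ifs
  · trans ∏ e ∈ S, X e
    · refine Finset.prod_congr ?_ fun _ _ => rfl
      ext
      simp
    rw [mul_left_comm, map_pow, map_neg, map_one, ← mul_pow]
    simp
  · simp

theorem aeval_graphPolynomial {R : Type*} [CommRing R] (v : V) (α : E → R) :
    aeval α G.graphPolynomial =
      (-1) ^ (Fintype.card V - 1) * borderedDet (G.reducedIncidence v R) ∅ α := by
  rw [G.graphPolynomial_eq v, map_mul, map_pow, map_neg, map_one]
  congr 1
  have := map_borderedDet (aeval α : MvPolynomial E ℤ →ₐ[ℤ] R).toRingHom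
    (G.reducedIncidence v (MvPolynomial E ℤ)) ∅ X
  rw [G.map_reducedIncidence] at this
  refine Eq.trans this ?_
  congr 1
  ext; simp

theorem dodgson_singleton (v : V) (i j : E) (K : Finset E) :
    G.dodgson v [i] [j] K = (-1) ^ (Fintype.card V - 1) *
      borderedMinor (G.reducedIncidence v (MvPolynomial E ℤ)) ∅ i j
        fun e => if e ∈ K then 0 else X e := by
  rw [dodgson, signedMinor, if_pos (by simp)]
  simp only [List.map_cons, List.map_nil, List.cons_append, List.nil_append, List.zip_cons_cons,
    List.zip_nil_right, List.foldl_cons, List.foldl_nil]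
  rw [det_updateRow_inr, submatrix_updateRow_inl, single_comp_sumMap, laplacian_submatrix,
    borderedMinor]

theorem dodgson_pair (v : V) {i j e : E} (hi : e ≠ i) (hj : e ≠ j) (K : Finset E) :
    G.dodgson v [i, e] [j, e] K = (-1) ^ (Fintype.card V - 1) *
      borderedMinor (G.reducedIncidence v (MvPolynomial E ℤ)) {e} i j
        fun e => if e ∈ K then 0 else X e := by
  rw [dodgson, signedMinor, if_pos (by simp [hi.symm, hj.symm])]
  simp only [List.map_cons, List.map_nil, List.cons_append, List.nil_append, List.zip_cons_cons,
    List.zip_nil_right, List.foldl_cons, List.foldl_nil]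
  rw [det_updateRow_inr, submatrix_updateRow_inl, submatrix_updateRow_inl, single_comp_sumMap,
    single_comp_sumMap, laplacian_submatrix, ← insert_empty_eq, borderedMinor_insert _ _ _ hi hj]

end Multigraph

/-! ### Legendre sums in one variable -/

section CharacterSums

variable {F : Type*} [Field F] [Fintype F]

/-- Only the coefficient `A ^ m` of `a ^ (q - 1)` contributes to the sum over `F`. -/
theorem sum_pow_quadratic (A B C : F) (m : ℕ) (hm : 2 * m = Fintype.card F - 1) :
    ∑ a : F, (A * a ^ 2 + B * a + C) ^ m = - A ^ m := by
  have hq : 1 < Fintype.card F := Fintype.one_lt_card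
  set f : Polynomial F := Polynomial.C A * Polynomial.X ^ 2 + Polynomial.C B * Polynomial.X +
    Polynomial.C C with hf
  have hfdeg : f.natDegree ≤ 2 := Polynomial.natDegree_quadratic_le
  have hdeg : (f ^ m).natDegree ≤ 2 * m := by
    rw [mul_comm]
    exact Polynomial.natDegree_pow_le_of_le m hfdeg
  have hcoeff : (f ^ m).coeff (2 * m) = A ^ m := by
    rw [mul_comm, Polynomial.coeff_pow_of_natDegree_le hfdeg]
    simp [hf]
  have h1 : ∀ a : F, (A * a ^ 2 + B * a + C) ^ m =
      ∑ k ∈ Finset.range (2 * m + 1), (f ^ m).coeff k * a ^ k := by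
    intro a
    rw [← Polynomial.eval_eq_sum_range' (Nat.lt_succ_of_le hdeg)]
    simp [hf]
  have h2 : ∑ a : F, a ^ (2 * m) = -1 := by
    classical
    have hz : ∀ a : F, a ^ (2 * m) = 1 - if a = 0 then 1 else 0 := by
      intro a
      rw [hm]
      split_ifs with h
      · rw [h, zero_pow (by omega), sub_self]
      · rw [FiniteField.pow_card_sub_one_eq_one _ h, sub_zero]
    simp only [hz, Finset.sum_sub_distrib]
    simp
  simp only [h1]
  rw [Finset.sum_comm, Finset.sum_range_succ, Finset.sum_eq_zero, zero_add, ← Finset.mul_sum, h2,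
    hcoeff, mul_neg_one]
  intro k hk
  rw [← Finset.mul_sum, FiniteField.sum_pow_lt_card_sub_one, mul_zero]
  rw [← hm]
  exact Finset.mem_range.mp hk

variable [DecidableEq F]

theorem two_mul_card_div_two {F : Type*} [Field F] [Fintype F] (hF : ringChar F ≠ 2) :
    2 * (Fintype.card F / 2) = Fintype.card F - 1 := by
  have := FiniteField.odd_card_of_char_ne_two hF
  omega

theorem quadraticChar_sq_eq (x : F) : quadraticChar F (x ^ 2) = 1 - if x = 0 then 1 else 0 := by
  split_ifs with h
  · simp [h]
  · rw [quadraticChar_sq_one' h, sub_zero]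

theorem card_roots_quadratic (hF : ringChar F ≠ 2) {A : F} (hA : A ≠ 0) (B C : F) :
    ∑ a : F, (if A * a ^ 2 + B * a + C = 0 then 1 else 0 : ℤ) =
      quadraticChar F (B ^ 2 - 4 * A * C) + 1 := by
  have h2 : (2 : F) ≠ 0 := Ring.two_ne_zero hF
  rw [← quadraticChar_card_sqrts hF, Finset.sum_boole]
  congr 1
  refine Finset.card_bij (fun a _ => 2 * A * a + B) ?_ ?_ ?_
  · intro a ha
    simp only [Finset.mem_filter, Finset.mem_univ, true_and] at ha
    simp only [Set.mem_toFinset, Set.mem_ofPred_eq]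
    linear_combination 4 * A * ha
  · intro a _ b _ h
    have h3 : 2 * A ≠ 0 := mul_ne_zero h2 hA
    exact mul_left_cancel₀ h3 (add_right_cancel h)
  · intro y hy
    simp only [Set.mem_toFinset, Set.mem_ofPred_eq] at hy
    refine ⟨(y - B) / (2 * A), ?_, by field_simp; ring⟩
    simp only [Finset.mem_filter, Finset.mem_univ, true_and]
    field_simp
    linear_combination hy

/-- Modulo `p`, the Legendre sum of the square of a quadratic polynomial. In degree two the number of
roots is `1 + χ(B ^ 2 - 4 A C)`; the term `χ(A ^ 2)` makes the formula hold for `A = 0`, too. -/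
theorem sum_quadraticChar_quadratic_sq (hF : ringChar F ≠ 2) (A B C : F) :
    ((∑ a : F, quadraticChar F ((A * a ^ 2 + B * a + C) ^ 2) : ℤ) : F) =
      - ((quadraticChar F (B ^ 2 - 4 * A * C) : ℤ) : F) - ((quadraticChar F (A ^ 2) : ℤ) : F) := by
  simp only [quadraticChar_sq_eq, Finset.sum_sub_distrib]
  by_cases hA : A = 0
  · subst hA
    have := sum_affine_eq_zero C B
    simp only [zero_mul, zero_add, mul_zero, sub_zero, quadraticChar_sq_eq]
    have hsum : ∑ a : F, (if B * a + C = 0 then 1 else 0 : ℤ) =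
        Fintype.card F * (if C = 0 ∧ B = 0 then 1 else 0) + 1 - (if B = 0 then 1 else 0) := by
      rw [← this]
      exact Finset.sum_congr rfl fun a _ => by rw [add_comm, mul_comm]
    rw [hsum]
    by_cases hB : B = 0 <;> by_cases hC : C = 0 <;> simp [hB, hC]
  · rw [card_roots_quadratic hF hA]
    simp [hA]
    ring

/-- Modulo `p`, the Legendre sum of a quadratic polynomial times the square of a linear one. -/
theorem sum_quadraticChar_quadratic_mul_sq (hF : ringChar F ≠ 2) (A B C D E : F) :
    ((∑ a : F, quadraticChar F ((A * a ^ 2 + B * a + C) * (D * a + E) ^ 2) : ℤ) : F) =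
      - ((quadraticChar F (A * E ^ 2 - B * D * E + C * D ^ 2) : ℤ) : F) -
        ((quadraticChar F (A * D ^ 2) : ℤ) : F) := by
  have hsum : ((∑ a : F, quadraticChar F (A * a ^ 2 + B * a + C) : ℤ) : F) =
      - ((quadraticChar F A : ℤ) : F) := by
    push_cast
    simp only [quadraticChar_eq_pow_of_char_ne_two' hF]
    exact sum_pow_quadratic A B C _ (two_mul_card_div_two hF)
  by_cases hD : D = 0
  · subst hD
    simp only [zero_mul, zero_add, map_mul, ← Finset.sum_mul, mul_zero, sub_zero, add_zero,
      Int.cast_mul, hsum, zero_pow two_ne_zero, quadraticChar_zero, Int.cast_zero]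
    ring
  · have h1 : ∀ a : F, quadraticChar F ((A * a ^ 2 + B * a + C) * (D * a + E) ^ 2) =
        quadraticChar F (A * a ^ 2 + B * a + C) -
          if a = - E / D then quadraticChar F (A * E ^ 2 - B * D * E + C * D ^ 2) else 0 := by
      intro a
      have ha : D * a + E = 0 ↔ a = - E / D := by
        rw [eq_div_iff hD]
        constructor <;> intro h <;> linear_combination h
      rw [map_mul, quadraticChar_sq_eq]
      simp only [ha]
      split_ifs with h
      · have h2 : A * E ^ 2 - B * D * E + C * D ^ 2 = (A * a ^ 2 + B * a + C) * D ^ 2 := by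
          rw [h]
          field_simp
          ring
        rw [h2, map_mul, quadraticChar_sq_one' hD]
        ring
      · ring
    simp only [h1, Finset.sum_sub_distrib, Finset.sum_ite_eq', Finset.mem_univ, if_true]
    rw [Int.cast_sub, hsum, map_mul, quadraticChar_sq_one' hD, mul_one]
    ring

end CharacterSums

/-! ### Degrees of the coefficients in one variable -/

section Coefficients

variable {σ R : Type*} [CommRing R] {e : σ}

/-- Coefficient extraction in a polynomial in `X e` whose coefficients do not involve `X e`. -/
theorem coeff_add_single_sum_mul_X_pow {A : ℕ → MvPolynomial σ R} (hA : ∀ k, e ∉ (A k).vars)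
    {s : Finset ℕ} {k : ℕ} (hk : k ∈ s) {m : σ →₀ ℕ} (hm : m e = 0) :
    coeff (m + Finsupp.single e k) (∑ j ∈ s, A j * X e ^ j) = coeff m (A k) := by
  classical
  rw [coeff_sum, Finset.sum_eq_single k]
  · rw [X_pow_eq_monomial, coeff_mul_monomial, mul_one]
  · intro j _ hj
    rw [X_pow_eq_monomial, coeff_mul_monomial']
    split_ifs with hle
    · rw [mul_one]
      by_contra h0
      apply hA j
      rw [mem_vars_iff_mem_support]
      refine ⟨_, mem_support_iff.mpr h0, ?_⟩
      have := hle e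
      simp only [Finsupp.single_eq_same, Finsupp.add_apply, hm, zero_add] at this
      simp only [Finsupp.mem_support_iff, Finsupp.tsub_apply, Finsupp.add_apply, hm,
        Finsupp.single_eq_same]
      omega
    · rfl
  · exact fun h => absurd hk h

theorem apply_eq_zero_of_mem_support {A : MvPolynomial σ R} (hA : e ∉ A.vars) {m : σ →₀ ℕ}
    (hm : m ∈ A.support) : m e = 0 := by
  by_contra h
  exact hA (mem_vars_iff_mem_support e |>.mpr ⟨m, hm, by simpa using h⟩)

theorem totalDegree_add_le_totalDegree_sum {A : ℕ → MvPolynomial σ R}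
    (hA : ∀ k, e ∉ (A k).vars) {s : Finset ℕ} {k : ℕ} (hk : k ∈ s) (h0 : A k ≠ 0) :
    (A k).totalDegree + k ≤ (∑ j ∈ s, A j * X e ^ j).totalDegree := by
  have key : ∀ m ∈ (A k).support, (m.sum fun _ x => x) + k ≤
      (∑ j ∈ s, A j * X e ^ j).totalDegree := by
    intro m hm
    have hme := apply_eq_zero_of_mem_support (hA k) hm
    have h1 : m + Finsupp.single e k ∈ (∑ j ∈ s, A j * X e ^ j).support := by
      rw [mem_support_iff, coeff_add_single_sum_mul_X_pow hA hk hme]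
      exact mem_support_iff.mp hm
    have h2 := le_totalDegree h1
    rwa [Finsupp.sum_add_index' (fun _ => rfl) (fun _ _ _ => rfl),
      Finsupp.sum_single_index rfl] at h2
  obtain ⟨m, hm⟩ := support_nonempty.mpr h0
  have hk' := key m hm
  have : (A k).totalDegree ≤ (∑ j ∈ s, A j * X e ^ j).totalDegree - k :=
    Finset.sup_le fun m hm => by have := key m hm; omega
  omega

theorem totalDegree_coeff_linear {D E : MvPolynomial σ R} (hD : e ∉ D.vars) (hE : e ∉ E.vars) :
    (D = 0 ∨ D.totalDegree + 1 ≤ (D * X e + E).totalDegree) ∧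
      (E = 0 ∨ E.totalDegree ≤ (D * X e + E).totalDegree) := by
  let f : ℕ → MvPolynomial σ R := fun k => if k = 0 then E else D
  have hf : ∀ k, e ∉ (f k).vars := by intro k; simp only [f]; split_ifs <;> assumption
  have hsum : ∑ j ∈ Finset.range 2, f j * X e ^ j = D * X e + E := by
    simp [Finset.sum_range_succ, f]; ring
  rw [← hsum]
  refine ⟨or_iff_not_imp_left.mpr fun h => ?_, or_iff_not_imp_left.mpr fun h => ?_⟩
  · exact totalDegree_add_le_totalDegree_sum hf (k := 1) (by simp) (by simpa [f] using h)
  · exact totalDegree_add_le_totalDegree_sum hf (k := 0) (by simp) (by simpa [f] using h)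

theorem totalDegree_coeff_quadratic {A B C : MvPolynomial σ R} (hA : e ∉ A.vars)
    (hB : e ∉ B.vars) (hC : e ∉ C.vars) :
    (A = 0 ∨ A.totalDegree + 2 ≤ (A * X e ^ 2 + B * X e + C).totalDegree) ∧
      (B = 0 ∨ B.totalDegree + 1 ≤ (A * X e ^ 2 + B * X e + C).totalDegree) ∧
      (C = 0 ∨ C.totalDegree ≤ (A * X e ^ 2 + B * X e + C).totalDegree) := by
  let f : ℕ → MvPolynomial σ R := fun k => if k = 0 then C else if k = 1 then B else A
  have hf : ∀ k, e ∉ (f k).vars := by intro k; simp only [f]; split_ifs <;> assumption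
  have hsum : ∑ j ∈ Finset.range 3, f j * X e ^ j = A * X e ^ 2 + B * X e + C := by
    simp [Finset.sum_range_succ, f]; ring
  rw [← hsum]
  refine ⟨or_iff_not_imp_left.mpr fun h => ?_, or_iff_not_imp_left.mpr fun h => ?_,
    or_iff_not_imp_left.mpr fun h => ?_⟩
  · exact totalDegree_add_le_totalDegree_sum hf (k := 2) (by simp) (by simpa [f] using h)
  · exact totalDegree_add_le_totalDegree_sum hf (k := 1) (by simp) (by simpa [f] using h)
  · exact totalDegree_add_le_totalDegree_sum hf (k := 0) (by simp) (by simpa [f] using h)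

theorem eq_zero_of_sum_mul_X_pow_eq_zero {A : ℕ → MvPolynomial σ R}
    (hA : ∀ k, e ∉ (A k).vars) {s : Finset ℕ} {k : ℕ} (hk : k ∈ s)
    (h : ∑ j ∈ s, A j * X e ^ j = 0) : A k = 0 := by
  by_contra h0
  obtain ⟨m, hm⟩ := support_nonempty.mpr h0
  have := coeff_add_single_sum_mul_X_pow hA hk (apply_eq_zero_of_mem_support (hA k) hm)
  rw [h, coeff_zero] at this
  exact mem_support_iff.mp hm this.symm

theorem eq_zero_of_linear_eq_zero {D E : MvPolynomial σ R} (hD : e ∉ D.vars) (hE : e ∉ E.vars)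
    (h : D * X e + E = 0) : D = 0 ∧ E = 0 := by
  let f : ℕ → MvPolynomial σ R := fun k => if k = 0 then E else D
  have hf : ∀ k, e ∉ (f k).vars := by intro k; simp only [f]; split_ifs <;> assumption
  have hsum : ∑ j ∈ Finset.range 2, f j * X e ^ j = 0 := by
    rw [← h]; simp [Finset.sum_range_succ, f]; ring
  exact ⟨eq_zero_of_sum_mul_X_pow_eq_zero hf (k := 1) (by simp) hsum,
    eq_zero_of_sum_mul_X_pow_eq_zero hf (k := 0) (by simp) hsum⟩

theorem eq_zero_of_quadratic_eq_zero {A B C : MvPolynomial σ R} (hA : e ∉ A.vars)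
    (hB : e ∉ B.vars) (hC : e ∉ C.vars) (h : A * X e ^ 2 + B * X e + C = 0) :
    A = 0 ∧ B = 0 ∧ C = 0 := by
  let f : ℕ → MvPolynomial σ R := fun k => if k = 0 then C else if k = 1 then B else A
  have hf : ∀ k, e ∉ (f k).vars := by intro k; simp only [f]; split_ifs <;> assumption
  have hsum : ∑ j ∈ Finset.range 3, f j * X e ^ j = 0 := by
    rw [← h]; simp [Finset.sum_range_succ, f]; ring
  exact ⟨eq_zero_of_sum_mul_X_pow_eq_zero hf (k := 2) (by simp) hsum,
    eq_zero_of_sum_mul_X_pow_eq_zero hf (k := 1) (by simp) hsum,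
    eq_zero_of_sum_mul_X_pow_eq_zero hf (k := 0) (by simp) hsum⟩

theorem totalDegree_mul_mul_le {p q r : MvPolynomial σ R} {a b c : ℕ} (hp : p.totalDegree ≤ a)
    (hq : q.totalDegree ≤ b) (hr : r.totalDegree ≤ c) : (p * q * r).totalDegree ≤ a + b + c :=
  (totalDegree_mul _ _).trans (add_le_add ((totalDegree_mul _ _).trans (add_le_add hp hq)) hr)

/-- The reduction lowers the degree bound `2 d` by two, and the term `A ^ 2` that is dropped modulo
`p` meets the bound of `sum_zeroOn_quadraticChar_eq_zero` in one variable less. -/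
theorem totalDegree_square_reduction [IsDomain R] {A B C : MvPolynomial σ R} (hA : e ∉ A.vars)
    (hB : e ∉ B.vars) (hC : e ∉ C.vars) {d : ℕ}
    (h : ((A * X e ^ 2 + B * X e + C) ^ 2).totalDegree ≤ 2 * d) :
    (B ^ 2 - 4 * A * C).totalDegree ≤ 2 * (d - 1) ∧
      (A ^ 2 = 0 ∨ (A ^ 2).totalDegree < 2 * (d - 1)) := by
  obtain ⟨hA', hB', hC'⟩ := totalDegree_coeff_quadratic hA hB hC
  set Q := A * X e ^ 2 + B * X e + C with hQ
  have hQd : Q.totalDegree ≤ d := by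
    by_cases hQ0 : Q = 0
    · simp [hQ0]
    · rw [pow_two, totalDegree_mul_of_isDomain hQ0 hQ0] at h
      omega
  have h4 : (4 : MvPolynomial σ R).totalDegree ≤ 0 := by
    rw [← map_ofNat MvPolynomial.C 4, totalDegree_C]
  constructor
  · refine (totalDegree_sub _ _).trans (max_le ?_ ?_)
    · rcases hB' with rfl | hB'
      · simp
      · exact (totalDegree_pow _ _).trans (by omega)
    · rcases hA' with rfl | hA'
      · simp
      rcases hC' with rfl | hC'
      · simp
      exact (totalDegree_mul_mul_le h4 le_rfl le_rfl).trans (by omega)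
  · rcases hA' with rfl | hA'
    · simp
    · exact Or.inr ((totalDegree_pow _ _).trans_lt (by omega))

/-- The analogue of `totalDegree_square_reduction` in the presence of a square factor. The dropped
term is `A * D ^ 2`. -/
theorem totalDegree_squareFactor_reduction [IsDomain R] {A B C D E : MvPolynomial σ R}
    (hA : e ∉ A.vars) (hB : e ∉ B.vars) (hC : e ∉ C.vars) (hD : e ∉ D.vars) (hE : e ∉ E.vars)
    {d : ℕ} (h : ((A * X e ^ 2 + B * X e + C) * (D * X e + E) ^ 2).totalDegree ≤ 2 * d) :
    (A * E ^ 2 - B * D * E + C * D ^ 2).totalDegree ≤ 2 * (d - 1) ∧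
      (A * D ^ 2 = 0 ∨ (A * D ^ 2).totalDegree < 2 * (d - 1)) := by
  by_cases hQ0 : A * X e ^ 2 + B * X e + C = 0
  · obtain ⟨rfl, rfl, rfl⟩ := eq_zero_of_quadratic_eq_zero hA hB hC hQ0
    simp
  by_cases hL0 : D * X e + E = 0
  · obtain ⟨rfl, rfl⟩ := eq_zero_of_linear_eq_zero hD hE hL0
    simp
  obtain ⟨hA', hB', hC'⟩ := totalDegree_coeff_quadratic hA hB hC
  obtain ⟨hD', hE'⟩ := totalDegree_coeff_linear hD hE
  rw [pow_two (D * X e + E), totalDegree_mul_of_isDomain hQ0 (mul_ne_zero hL0 hL0),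
    totalDegree_mul_of_isDomain hL0 hL0] at h
  simp only [pow_two, ← mul_assoc]
  refine ⟨(totalDegree_add _ _).trans (max_le ((totalDegree_sub _ _).trans (max_le ?_ ?_)) ?_), ?_⟩
  · rcases hA' with rfl | hA'
    · simp
    rcases hE' with rfl | hE'
    · simp
    exact (totalDegree_mul_mul_le le_rfl le_rfl le_rfl).trans (by omega)
  · rcases hB' with rfl | hB'
    · simp
    rcases hD' with rfl | hD'
    · simp
    rcases hE' with rfl | hE'
    · simp
    exact (totalDegree_mul_mul_le le_rfl le_rfl le_rfl).trans (by omega)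
  · rcases hC' with rfl | hC'
    · simp
    rcases hD' with rfl | hD'
    · simp
    exact (totalDegree_mul_mul_le le_rfl le_rfl le_rfl).trans (by omega)
  · rcases hA' with rfl | hA'
    · simp
    rcases hD' with rfl | hD'
    · simp
    exact Or.inr ((totalDegree_mul_mul_le le_rfl le_rfl le_rfl).trans_lt (by omega))

end Coefficients

/-! ### Reduction of Legendre sums -/

section LegendreSums

theorem nodup_append_singleton {E : Type*} {l : List E} {e : E} (hl : l.Nodup) (he : e ∉ l) :
    (l ++ [e]).Nodup := by
  rw [← List.concat_eq_append]
  exact hl.concat he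

variable {E : Type*} [Fintype E] [DecidableEq E] {F : Type*} [Field F] [Fintype F] [DecidableEq F]

theorem legendreSum_eq_sum_zeroOn (l : List E) (P : MvPolynomial E ℤ) :
    legendreSum F l P = ∑ α ∈ zeroOn F l.toFinset, quadraticChar F (aeval α P) := by
  rw [legendreSum]
  refine Finset.sum_bij' (fun x _ e => if h : e ∉ l then x ⟨e, h⟩ else 0)
    (fun α _ e => α e.1) ?_ ?_ ?_ ?_ ?_
  · intro x _
    rw [mem_zeroOn]
    intro e he
    simp [List.mem_toFinset.mp he]
  · simp
  · intro x _
    ext e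
    simp [e.2]
  · intro α hα
    rw [mem_zeroOn] at hα
    ext e
    by_cases he : e ∈ l
    · simp [he, hα e (List.mem_toFinset.mpr he)]
    · simp [he]
  · intro x _
    rfl

/-- By Euler's criterion the Legendre symbol is the power with exponent `(q - 1) / 2`, so the vanishing
of Chevalley–Warning holds below twice the number of variables. -/
theorem sum_zeroOn_quadraticChar_eq_zero (hF : ringChar F ≠ 2) (s : Finset E)
    (Q : MvPolynomial E ℤ)
    (hQ : Q = 0 ∨ Q.totalDegree < 2 * (Fintype.card E - s.card)) :
    ((∑ α ∈ zeroOn F s, quadraticChar F (aeval α Q) : ℤ) : F) = 0 := by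
  rcases hQ with rfl | hQ
  · simp
  · push_cast
    simp only [quadraticChar_eq_pow_of_char_ne_two' hF]
    have hq : 1 < Fintype.card F := Fintype.one_lt_card
    have h2 := two_mul_card_div_two hF
    rw [← sum_zeroOn_eval_eq_zero s ((map (Int.castRingHom F) Q) ^ (Fintype.card F / 2))]
    · refine Finset.sum_congr rfl fun α _ => ?_
      rw [map_pow, eval_map]
      rfl
    · refine (totalDegree_pow _ _).trans_lt ?_
      have h3 : (map (Int.castRingHom F) Q).totalDegree ≤ Q.totalDegree :=
        Finset.sup_mono (support_map_subset _ _)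
      calc _ ≤ Fintype.card F / 2 * Q.totalDegree := Nat.mul_le_mul_left _ h3
        _ < Fintype.card F / 2 * (2 * (Fintype.card E - s.card)) :=
          Nat.mul_lt_mul_of_pos_left hQ (by omega)
        _ = _ := by rw [← h2]; ring

theorem aeval_update_of_notMem_vars {E R S : Type*} [DecidableEq E] [CommRing R] [CommRing S]
    [Algebra R S] {A : MvPolynomial E R} {e : E} (hA : e ∉ A.vars) (α : E → S) (a : S) :
    aeval (Function.update α e a) A = aeval α A := by
  refine eval₂Hom_congr' rfl (fun i hi _ => ?_) rfl
  rw [Function.update_of_ne]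
  rintro rfl
  exact hA hi

theorem legendreSum_append {l : List E} {e : E} (he : e ∉ l) (P : MvPolynomial E ℤ) :
    legendreSum F l P = ∑ α ∈ zeroOn F (l ++ [e]).toFinset, ∑ a,
      quadraticChar F (aeval (Function.update α e a) P) := by
  have : (l ++ [e]).toFinset = insert e l.toFinset := by ext; simp
  rw [legendreSum_eq_sum_zeroOn, this, sum_zeroOn_eq_sum_insert (by simpa using he)]

theorem legendreSum_square_reduction (hF : ringChar F ≠ 2) {l : List E} {e : E} (hl : l.Nodup)
    (he : e ∉ l) {A B C : MvPolynomial E ℤ} (hA : e ∉ A.vars) (hB : e ∉ B.vars) (hC : e ∉ C.vars)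
    (hdeg : ((A * X e ^ 2 + B * X e + C) ^ 2).totalDegree ≤ 2 * (Fintype.card E - l.length)) :
    (legendreSum F l ((A * X e ^ 2 + B * X e + C) ^ 2) : F) =
      - (legendreSum F (l ++ [e]) (B ^ 2 - 4 * A * C) : F) := by
  have hcard : (l ++ [e]).toFinset.card = l.length + 1 := by
    rw [List.toFinset_card_of_nodup (nodup_append_singleton hl he)]
    simp
  have h0 := sum_zeroOn_quadraticChar_eq_zero hF (l ++ [e]).toFinset (A ^ 2) (by
    rw [hcard]
    have := (totalDegree_square_reduction hA hB hC hdeg).2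
    rwa [Nat.sub_sub] at this)
  rw [legendreSum_append he, legendreSum_eq_sum_zeroOn, Int.cast_sum, Int.cast_sum,
    ← sub_zero (- _), ← h0, Int.cast_sum, ← Finset.sum_neg_distrib, ← Finset.sum_sub_distrib]
  refine Finset.sum_congr rfl fun α _ => ?_
  simp only [map_pow, map_add, map_mul, map_sub, aeval_X, Function.update_self,
    aeval_update_of_notMem_vars hA, aeval_update_of_notMem_vars hB,
    aeval_update_of_notMem_vars hC, map_ofNat]
  have := sum_quadraticChar_quadratic_sq hF (aeval α A) (aeval α B) (aeval α C)
  simpa only [map_pow] using this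

theorem legendreSum_squareFactor_reduction (hF : ringChar F ≠ 2) {l : List E} {e : E}
    (hl : l.Nodup) (he : e ∉ l) {A B C D E₀ : MvPolynomial E ℤ} (hA : e ∉ A.vars) (hB : e ∉ B.vars)
    (hC : e ∉ C.vars) (hD : e ∉ D.vars) (hE : e ∉ E₀.vars)
    (hdeg : ((A * X e ^ 2 + B * X e + C) * (D * X e + E₀) ^ 2).totalDegree ≤
      2 * (Fintype.card E - l.length)) :
    (legendreSum F l ((A * X e ^ 2 + B * X e + C) * (D * X e + E₀) ^ 2) : F) =
      - (legendreSum F (l ++ [e]) (A * E₀ ^ 2 - B * D * E₀ + C * D ^ 2) : F) := by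
  have hcard : (l ++ [e]).toFinset.card = l.length + 1 := by
    rw [List.toFinset_card_of_nodup (nodup_append_singleton hl he)]
    simp
  have h0 := sum_zeroOn_quadraticChar_eq_zero hF (l ++ [e]).toFinset (A * D ^ 2) (by
    rw [hcard]
    have := (totalDegree_squareFactor_reduction hA hB hC hD hE hdeg).2
    rwa [Nat.sub_sub] at this)
  rw [legendreSum_append he, legendreSum_eq_sum_zeroOn, Int.cast_sum, Int.cast_sum,
    ← sub_zero (- _), ← h0, Int.cast_sum, ← Finset.sum_neg_distrib, ← Finset.sum_sub_distrib]
  refine Finset.sum_congr rfl fun α _ => ?_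
  simp only [map_pow, map_add, map_mul, map_sub, aeval_X, Function.update_self,
    aeval_update_of_notMem_vars hA, aeval_update_of_notMem_vars hB,
    aeval_update_of_notMem_vars hC, aeval_update_of_notMem_vars hD,
    aeval_update_of_notMem_vars hE]
  have := sum_quadraticChar_quadratic_mul_sq hF (aeval α A) (aeval α B) (aeval α C) (aeval α D)
    (aeval α E₀)
  simpa only [map_pow, map_mul] using this

end LegendreSums

namespace Multigraph

variable {V E : Type*} [Fintype V] [Fintype E] [DecidableEq V] [DecidableEq E]
  {F : Type*} [Field F] [Fintype F] [DecidableEq F]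

theorem notMem_vars_of_mem_remaining {E : Type*} {l : List E} {e : E} {A : MvPolynomial E ℤ}
    (hA : A ∈ remaining (l ++ [e])) : e ∉ A.vars := by
  intro h
  have := mem_supported.mp hA h
  simp at this

theorem IsQuadraticInvariant.nodup_and_length {G : Multigraph V E} {l : List E}
    {P : MvPolynomial E ℤ} (h : G.IsQuadraticInvariant l P) : l.Nodup ∧ 3 ≤ l.length := by
  induction h with
  | initial v e₁ e₂ e₃ hd => exact ⟨hd, le_rfl⟩
  | square h e he A B C hA hB hC hP ih =>
    refine ⟨nodup_append_singleton ih.1 he, ?_⟩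
    simp
    omega
  | squareFactor h e he A B C D E₀ hA hB hC hD hE hP ih =>
    refine ⟨nodup_append_singleton ih.1 he, ?_⟩
    simp
    omega

/-- For three edges the degree is at most `2 (2 h - 3)` with `h = |E| - |V| + 1`, which `hEV` bounds
by `2 (|E| - 3)`. -/
theorem IsQuadraticInvariant.totalDegree_le {G : Multigraph V E}
    (hEV : Fintype.card E ≤ 2 * (Fintype.card V - 1)) {l : List E}
    {P : MvPolynomial E ℤ} (h : G.IsQuadraticInvariant l P) :
    P.totalDegree ≤ 2 * (Fintype.card E - l.length) := by
  induction h with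
  | initial v e₁ e₂ e₃ hd =>
    simp only [List.nodup_cons, List.mem_cons, List.not_mem_nil, or_false, not_or] at hd
    have h₁ : e₃ ≠ e₁ := Ne.symm hd.1.2
    have h₂ : e₃ ≠ e₂ := Ne.symm hd.2.1
    have hα : ∀ K : Finset E, ∀ e,
        (if e ∈ K then 0 else X e : MvPolynomial E ℤ).totalDegree ≤ 1 := by
      intro K e
      split_ifs
      · simp
      · exact (totalDegree_X e).le
    have hW : Fintype.card {w // w ≠ v} = Fintype.card V - 1 := by simp
    rw [G.dodgson_pair v h₁ h₂, G.dodgson_singleton v, ← G.map_reducedIncidence v (C : ℤ →+* _)]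
    have hsign : ∀ n : ℕ, ((-1 : MvPolynomial E ℤ) ^ n).totalDegree = 0 := by
      intro n
      rw [← map_one C, ← map_neg, ← map_pow, totalDegree_C]
    by_cases hf : borderedMinor ((G.reducedIncidence v ℤ).map C) {e₃} e₁ e₂
        (fun e => if e ∈ (∅ : Finset E) then 0 else X e) = 0
    · rw [hf]; simp
    by_cases hg : borderedMinor ((G.reducedIncidence v ℤ).map C) ∅ e₁ e₂
        (fun e => if e ∈ ({e₃} : Finset E) then 0 else X e) = 0
    · rw [hg]; simp
    have h1 := totalDegree_borderedMinor_le _ {e₃} e₂ (by simpa using h₁.symm) _ (hα ∅) hf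
    have h2 := totalDegree_borderedMinor_le _ ∅ e₂ (by simp) _ (hα {e₃}) hg
    rw [hW] at h1 h2
    rw [Finset.card_singleton] at h1
    rw [Finset.card_empty] at h2
    refine (totalDegree_pow _ _).trans (Nat.mul_le_mul_left 2 ?_)
    refine (totalDegree_mul _ _).trans ((add_le_add (totalDegree_mul _ _)
      (totalDegree_mul _ _)).trans ?_)
    rw [hsign]
    simp only [List.length_cons, List.length_nil]
    omega
  | @square l P h e he A B C hA hB hC hP ih =>
    subst hP
    have := (totalDegree_square_reduction (notMem_vars_of_mem_remaining hA)
      (notMem_vars_of_mem_remaining hB) (notMem_vars_of_mem_remaining hC) ih).1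
    rwa [Nat.sub_sub, ← List.length_singleton (a := e), ← List.length_append] at this
  | @squareFactor l P h e he A B C D E₀ hA hB hC hD hE hP ih =>
    subst hP
    have := (totalDegree_squareFactor_reduction (notMem_vars_of_mem_remaining hA)
      (notMem_vars_of_mem_remaining hB) (notMem_vars_of_mem_remaining hC)
      (notMem_vars_of_mem_remaining hD) (notMem_vars_of_mem_remaining hE) ih).1
    rwa [Nat.sub_sub, ← List.length_singleton (a := e), ← List.length_append] at this

theorem pointCount_eq (G : Multigraph V E) (v : V) :
    (G.pointCount F : ℤ) = numZeros ∅ (borderedDet (G.reducedIncidence v F) ∅) := by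
  rw [pointCount, Nat.card_eq_fintype_card, Fintype.card_subtype, numZeros, zeroOn]
  simp only [G.aeval_graphPolynomial v]
  simp

theorem legendreSum_initial (G : Multigraph V E) (v : V) {e₁ e₂ e₃ : E} (h₁ : e₃ ≠ e₁)
    (h₂ : e₃ ≠ e₂) :
    legendreSum F [e₁, e₂, e₃] ((G.dodgson v [e₁, e₃] [e₂, e₃] ∅ * G.dodgson v [e₁] [e₂] {e₃}) ^ 2) =
      ∑ α ∈ zeroOn F {e₃, e₂, e₁}, quadraticChar F
        ((borderedMinor (G.reducedIncidence v F) {e₃} e₁ e₂ α *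
          borderedMinor (G.reducedIncidence v F) ∅ e₁ e₂ α) ^ 2) := by
  have hset : [e₁, e₂, e₃].toFinset = {e₃, e₂, e₁} := by
    ext
    simp only [List.mem_toFinset, List.mem_cons, List.not_mem_nil, or_false, Finset.mem_insert,
      Finset.mem_singleton]
    tauto
  rw [legendreSum_eq_sum_zeroOn, hset]
  refine Finset.sum_congr rfl fun α hα => ?_
  have h0 : α e₃ = 0 := mem_zeroOn.mp hα e₃ (by simp)
  have key : ∀ K ⊆ ({e₃} : Finset E), ∀ Δ, aeval α (borderedMinor
      (G.reducedIncidence v (MvPolynomial E ℤ)) Δ e₁ e₂ fun e => if e ∈ K then 0 else X e) =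
      borderedMinor (G.reducedIncidence v F) Δ e₁ e₂ α := by
    intro K hK Δ
    have := map_borderedMinor (aeval α : MvPolynomial E ℤ →ₐ[ℤ] F).toRingHom
      (G.reducedIncidence v (MvPolynomial E ℤ)) Δ e₁ e₂ fun e => if e ∈ K then 0 else X e
    rw [G.map_reducedIncidence] at this
    refine Eq.trans this ?_
    congr 1
    ext e
    by_cases he : e ∈ K
    · have := Finset.mem_singleton.mp (hK he)
      subst this
      simp [he, h0]
    · simp [he]
  rw [G.dodgson_pair v h₁ h₂, G.dodgson_singleton v]
  refine congrArg _ ?_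
  simp only [map_pow, map_mul, map_neg, map_one, key ∅ (Finset.empty_subset _),
    key {e₃} subset_rfl]
  rw [mul_mul_mul_comm, ← mul_pow, neg_one_mul, neg_neg, one_pow, one_mul]

theorem IsQuadraticInvariant.dvd_pointCount_sub {G : Multigraph V E}
    (hEV : Fintype.card E ≤ 2 * (Fintype.card V - 1)) (hV : 4 ≤ Fintype.card V)
    (hE : 3 ≤ Fintype.card E) (p : ℕ) [CharP F p] (hF : ringChar F ≠ 2) {l : List E}
    {P : MvPolynomial E ℤ} (h : G.IsQuadraticInvariant l P) :
    (p : ℤ) * Fintype.card F ^ 2 ∣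
      G.pointCount F - Fintype.card F ^ 2 * ((-1) ^ (l.length - 1) * legendreSum F l P) := by
  -- A reduction adds one edge and changes the sign of the Legendre sum modulo `p`.
  have step : ∀ {l l' : List E} {P P' : MvPolynomial E ℤ}, l'.length = l.length + 1 →
      3 ≤ l.length → (legendreSum F l P : F) = - (legendreSum F l' P' : F) →
      (p : ℤ) * Fintype.card F ^ 2 ∣
        G.pointCount F - Fintype.card F ^ 2 * ((-1) ^ (l.length - 1) * legendreSum F l P) →
      (p : ℤ) * Fintype.card F ^ 2 ∣
        G.pointCount F - Fintype.card F ^ 2 * ((-1) ^ (l'.length - 1) * legendreSum F l' P') := by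
    intro l l' P P' hl' hl hs h
    have h1 : (p : ℤ) ∣ legendreSum F l P + legendreSum F l' P' := by
      rw [← CharP.intCast_eq_zero_iff F p]
      push_cast
      rw [hs, neg_add_cancel]
    obtain ⟨a, ha⟩ := h
    obtain ⟨b, hb⟩ := h1
    obtain ⟨n, hn⟩ : ∃ n, l.length = n + 1 := ⟨l.length - 1, by omega⟩
    rw [hn, Nat.add_sub_cancel] at ha
    rw [hl', hn, Nat.add_sub_cancel, pow_succ]
    exact ⟨a + (-1) ^ n * b, by linear_combination ha + (Fintype.card F : ℤ) ^ 2 * (-1) ^ n * hb⟩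
  induction h with
  | initial v e₁ e₂ e₃ hd =>
    simp only [List.nodup_cons, List.mem_cons, List.not_mem_nil, or_false, not_or] at hd
    have h₁ : e₃ ≠ e₁ := Ne.symm hd.1.2
    have h₂ : e₃ ≠ e₂ := Ne.symm hd.2.1
    have hW : Fintype.card {w // w ≠ v} = Fintype.card V - 1 := by simp
    have := dvd_numZeros_borderedDet_sub p (by omega) hE (by omega)
      (G.reducedIncidence v F) hd.1.1 h₁ h₂
    rw [← pointCount_eq, ← legendreSum_initial G v h₁ h₂] at this
    simpa using this
  | square h e he A B C hA hB hC hP ih =>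
    obtain ⟨hl, hlen⟩ := h.nodup_and_length
    have hd := h.totalDegree_le hEV
    subst hP
    exact step (by simp) hlen (legendreSum_square_reduction hF hl he
      (notMem_vars_of_mem_remaining hA) (notMem_vars_of_mem_remaining hB)
      (notMem_vars_of_mem_remaining hC) hd) ih
  | squareFactor h e he A B C D E₀ hA hB hC hD hE hP ih =>
    obtain ⟨hl, hlen⟩ := h.nodup_and_length
    have hd := h.totalDegree_le hEV
    subst hP
    exact step (by simp) hlen (legendreSum_squareFactor_reduction hF hl he
      (notMem_vars_of_mem_remaining hA) (notMem_vars_of_mem_remaining hB)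
      (notMem_vars_of_mem_remaining hC) (notMem_vars_of_mem_remaining hD)
      (notMem_vars_of_mem_remaining hE) hd) ih

end Multigraph

theorem theorem6p3 {V E : Type*} [Fintype V] [Fintype E] [DecidableEq V] [DecidableEq E]
    (G : Multigraph V E) (hconn : G.IsConnected)
    (hV : 4 ≤ Fintype.card V) (hE : 3 ≤ Fintype.card E)
    (hloops : 2 * G.h1 ≤ Fintype.card E)
    (p k : ℕ) (hp : p.Prime) (hodd : p ≠ 2)
    (F : Type*) [Field F] [Fintype F] [DecidableEq F] (hF : Fintype.card F = p ^ k)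
    (l : List E) (P : MvPolynomial E ℤ) (hP : G.IsQuadraticInvariant l P) :
    (p ^ k) ^ 2 ∣ G.pointCount F ∧
      (G.c2 F : ℤ) ≡ (-1) ^ (l.length - 1) * legendreSum F l P [ZMOD p] := by
  have hchar : CharP F p := by
    obtain ⟨p', hp'⟩ := CharP.exists F
    obtain ⟨n, hprime, hcard⟩ := FiniteField.card F p'
    have hdvd : p' ∣ p ^ k := by
      rw [← hF, hcard]
      exact dvd_pow_self _ n.ne_zero
    rwa [(Nat.prime_dvd_prime_iff_eq hprime hp).mp (hprime.dvd_of_dvd_pow hdvd)] at hp'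
  have hF2 : ringChar F ≠ 2 := by rwa [ringChar.eq F p]
  have hEV := G.card_le_of_two_mul_h1_le (by omega) hloops
  obtain ⟨a, ha⟩ := hP.dvd_pointCount_sub hEV hV hE p hF2
  have hq : (p ^ k) ^ 2 ∣ G.pointCount F := by
    rw [← hF, ← Int.natCast_dvd_natCast]
    push_cast
    exact ⟨p * a + (-1) ^ (l.length - 1) * legendreSum F l P, by linear_combination ha⟩
  refine ⟨hq, ?_⟩
  obtain ⟨c, hc⟩ := hq
  have hpos : 0 < (p ^ k) ^ 2 := by
    have := hp.pos
    positivity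
  have hc2 : G.c2 F = c := by
    rw [Multigraph.c2, Nat.card_eq_fintype_card, hF, hc, Nat.mul_div_cancel_left _ hpos]
  rw [hc, hF] at ha
  push_cast at ha
  have hpos' : ((p : ℤ) ^ k) ^ 2 ≠ 0 := by exact_mod_cast hpos.ne'
  have hkey : (c : ℤ) - (-1) ^ (l.length - 1) * legendreSum F l P = p * a :=
    mul_left_cancel₀ hpos' (by linear_combination ha)
  rw [hc2]
  exact (Int.modEq_iff_dvd.mpr ⟨a, hkey⟩).symm
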